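/- Let $d\ge 1$ and $k\ge d+3$ be integers. Let $\mathcal A_d^k=(\mathbb{RP}^d)^k$ be the space of configurations $p=(p_1,\dots,p_k)$ of $k$ landmarks in real projective space, on which the projective linear group $\mathrm{PGL}=\mathrm{GL}(d+1,\mathbb R)/(\mathbb R\setminus\{0\})$ acts landmark-wise, and let $\mathfrak a_d^k=\mathcal A_d^k/\mathrm{PGL}$ be the space of projective shapes with the quotient topology. A configuration is called free if its isotropy group in $\mathrm{PGL}$ is trivial; let $\mathfrak f_d^k\subseteq\mathfrak a_d^k$ be the subspace of shapes of free configurations. It is a second countable (in general non-Hausdorff) smooth manifold of dimension $d(k-d-2)$; its smooth charts are the homeomorphisms $e$ from open subsets of $\mathfrak f_d^k$ onto open subsets of $\mathbb R^{d(k-d-2)}$ such that $e$ is a smooth function of the homogeneous coordinates of the landmarks and such that, locally, homogeneous coordinates of the shape $e^{-1}(x)$ can be chosen to depend smoothly on $x$. Let $n=(n_1,\dots,n_d)\in\mathbb N^d$ with $1\le n_1<n_2<\dots<n_d$ (projective subspace numbers), and let $\mathfrak{sn}_d^k(n)\subseteq\mathfrak a_d^k$ be the topological subspace of the shapes of all configurations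 $p$ with the following property: whenever $1\le j\le d$ and $I\subseteq\{1,\dots,k\}$ has $|I|\ge j$ and all $p_i$, $i\in I$, lie in a common $(j-1)$-dimensional projective subspace of $\mathbb{RP}^d$, then $|I|\le n_j$. Then the following statements are equivalent: (i) $\mathfrak{sn}_d^k(n)$ is Hausdorff; (ii) $\mathfrak{sn}_d^k(n)\subseteq\mathfrak f_d^k$; (iii) $\mathfrak{sn}_d^k(n)$ is an open, Hausdorff submanifold of the smooth manifold $\mathfrak f_d^k$; (iv) $n_j+n_{d+1-j}<k$ for all $1\le j\le d$. -/

import Mathlib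

open scoped LinearAlgebra.Projectivization MatrixGroups Manifold ContDiff Topology
open TopologicalSpace

namespace ProjShape

/-- Real projective space `ℝP^d`: the lines through the origin of `ℝ^(d+1)`. -/
abbrev RP (d : ℕ) : Type := ℙ ℝ (Fin (d + 1) → ℝ)

/-- `ℝP^d` carries the quotient topology of `ℝ^(d+1) ∖ {0}`. -/
noncomputable instance RP.instTopologicalSpace (d : ℕ) : TopologicalSpace (RP d) :=
  TopologicalSpace.coinduced
    (fun v : {v : Fin (d + 1) → ℝ // v ≠ 0} => Projectivization.mk ℝ v.1 v.2) inferInstance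

/-- The projective linear group `GL(d+1, ℝ) / (ℝ ∖ {0})`, acting on `ℝP^d` in the usual way. -/
abbrev PL (d : ℕ) : Type := PGL(Fin (d + 1), ℝ)

/-- Configurations of `k` landmarks in `ℝP^d`, with the product topology and the
landmark-wise action of the projective linear group. -/
abbrev Config (d k : ℕ) : Type := Fin k → RP d

/-- The space of projective shapes `(ℝP^d)^k / PGL`, with the quotient topology. -/
abbrev ShapeSpace (d k : ℕ) : Type := Quotient (MulAction.orbitRel (PL d) (Config d k))

/-- The projective shape of a configuration. -/
noncomputable def shape {d k : ℕ} (p : Config d k) : ShapeSpace d k := Quotient.mk _ p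

/-- Free configurations: those with trivial isotropy group in the projective linear group. -/
def freeConfigs (d k : ℕ) : Set (Config d k) := {p | MulAction.stabilizer (PL d) p = ⊥}

/-- Free shapes, i.e. the shapes of free configurations. -/
def freeShapes (d k : ℕ) : Set (ShapeSpace d k) := shape '' freeConfigs d k

/-- The projective subspace constraints fulfilled by `p`. The pair `(I, i)`, with `i : Fin d`,
has `|I| ≥ i + 1`, and all landmarks `p_l`, `l ∈ I`, lie in one projective subspace of dimension
`i`, i.e. in one linear subspace of dimension `i + 1`. -/
def constraints {d k : ℕ} (p : Config d k) : Set (Finset (Fin k) × Fin d) :=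
  {c | (c.2 : ℕ) + 1 ≤ c.1.card ∧
    ∃ S : Submodule ℝ (Fin (d + 1) → ℝ), Module.finrank ℝ S = (c.2 : ℕ) + 1 ∧
      ∀ l ∈ c.1, (p l).submodule ≤ S}

/-- The configurations bounded by the projective subspace numbers `n`; the entry `n i`, `i : Fin d`,
bounds the number of landmarks in an `i`-dimensional projective subspace. -/
def boundedConfigs {d : ℕ} (k : ℕ) (n : Fin d → ℕ) : Set (Config d k) :=
  {p | ∀ c ∈ constraints p, c.1.card ≤ n c.2}

/-- The shapes of the configurations bounded by the projective subspace numbers `n`. -/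
def boundedShapes {d : ℕ} (k : ℕ) (n : Fin d → ℕ) : Set (ShapeSpace d k) :=
  shape '' boundedConfigs k n

/-- Homogeneous coordinates of configurations: the open set of real `k × (d+1)` matrices (given
as families of rows) without vanishing row. -/
def HomCoords (d k : ℕ) : Opens (Fin k → Fin (d + 1) → ℝ) where
  carrier := {P | ∀ l, P l ≠ 0}
  is_open' := by
    simp only [Set.ofPred_forall]
    exact isOpen_iInter_of_finite fun l => isOpen_ne_fun (continuous_apply l) continuous_const

/-- The shape of the configuration with given homogeneous coordinates. -/
noncomputable def shapeOfMatrix {d k : ℕ} (P : HomCoords d k) : ShapeSpace d k :=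
  shape fun l => Projectivization.mk ℝ (P.1 l) (P.2 l)

/-- The space of dimension `d (k - d - 2)` on which the free shapes are modelled. -/
abbrev Model (d k : ℕ) : Type := EuclideanSpace ℝ (Fin (d * (k - d - 2)))

/-- The differentiable structure of the space of free shapes, as its set of all smooth charts: a
homeomorphism `e` from an open set of free shapes onto an open set of `ℝ^(d(k-d-2))` is a smooth
chart iff `e` is a smooth function of the homogeneous coordinates of the landmarks, and
homogeneous coordinates of the shape `e⁻¹(x)` can locally be chosen to depend smoothly on `x`.
Any two such charts are smoothly compatible, see `smoothCharts_compatible`. -/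
def smoothCharts (d k : ℕ) : Set (OpenPartialHomeomorph (freeShapes d k) (Model d k)) :=
  {e | (∃ F : HomCoords d k → Model d k,
        (∀ (P : HomCoords d k) (h : shapeOfMatrix P ∈ freeShapes d k),
          (⟨shapeOfMatrix P, h⟩ : freeShapes d k) ∈ e.source → F P = e ⟨shapeOfMatrix P, h⟩) ∧
        ContMDiffOn 𝓘(ℝ, Fin k → Fin (d + 1) → ℝ) 𝓘(ℝ, Model d k) ∞ F
          {P | shapeOfMatrix P ∈ Subtype.val '' e.source}) ∧
    ∀ x ∈ e.target, ∃ s : Model d k → HomCoords d k,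
      ContMDiffAt 𝓘(ℝ, Model d k) 𝓘(ℝ, Fin k → Fin (d + 1) → ℝ) ∞ s x ∧
      ∀ᶠ y in 𝓝 x, shapeOfMatrix (s y) = (e.symm y).1}

theorem smoothCharts_compatible {d k : ℕ}
    {e e' : OpenPartialHomeomorph (freeShapes d k) (Model d k)}
    (he : e ∈ smoothCharts d k) (he' : e' ∈ smoothCharts d k) :
    e.symm ≫ₕ e' ∈ contDiffGroupoid ∞ 𝓘(ℝ, Model d k) := by
  have key : ∀ {e e' : OpenPartialHomeomorph (freeShapes d k) (Model d k)},
      e ∈ smoothCharts d k → e' ∈ smoothCharts d k →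
      ContDiffOn ℝ ∞ (e.symm ≫ₕ e') (e.symm ≫ₕ e').source := by
    intro e e' he he' x hx
    apply ContDiffAt.contDiffWithinAt
    rw [← contMDiffAt_iff_contDiffAt]
    obtain ⟨⟨F, hF, hFs⟩, -⟩ := he'
    have hxt : x ∈ e.target := by
      have := hx.1; simpa using this
    obtain ⟨s, hs, hse⟩ := he.2 x hxt
    have hsrc : ∀ᶠ y in 𝓝 x, y ∈ (e.symm ≫ₕ e').source :=
      (e.symm ≫ₕ e').open_source.mem_nhds hx
    have hmem : ∀ᶠ y in 𝓝 x,
        s y ∈ {P : HomCoords d k | shapeOfMatrix P ∈ Subtype.val '' e'.source} := by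
      filter_upwards [hse, hsrc] with y hy hy'
      exact ⟨e.symm y, hy'.2, hy.symm⟩
    have hcomp : ContMDiffAt 𝓘(ℝ, Model d k) 𝓘(ℝ, Model d k) ∞ (F ∘ s) x := by
      have h1 := hFs (s x) hmem.self_of_nhds
      have h2 := h1.comp x (hs.contMDiffWithinAt 
        (s := s ⁻¹' {P | shapeOfMatrix P ∈ Subtype.val '' e'.source})) (fun y hy => hy)
      exact h2.contMDiffAt hmem
    refine hcomp.congr_of_eventuallyEq ?_
    filter_upwards [hse, hsrc] with y hy hy'
    have hfree : shapeOfMatrix (s y) ∈ freeShapes d k := by rw [hy]; exact (e.symm y).2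
    have heq : (⟨shapeOfMatrix (s y), hfree⟩ : freeShapes d k) = e.symm y := Subtype.ext hy
    have := hF (s y) hfree (by rw [heq]; exact hy'.2)
    simp only [Function.comp_apply, this, heq]
    rfl
  rw [contDiffGroupoid, mem_groupoid_of_pregroupoid]
  constructor
  · simpa [contDiffPregroupoid] using key he he'
  · simpa [contDiffPregroupoid] using key he' he

/-- `S` is an open, Hausdorff submanifold of the space of free shapes: the latter, with its smooth
charts, is a smooth manifold of dimension `d (k - d - 2)` (second countable, but not assumed
Hausdorff), and `S` is an open subset of it which, with the restricted charts, is a smooth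
manifold that is Hausdorff and second countable. -/
def IsOpenHausdorffSubmanifold {d k : ℕ} (S : Set (ShapeSpace d k)) : Prop :=
  ∃ cs : ChartedSpace (Model d k) (freeShapes d k),
    cs.atlas = smoothCharts d k ∧
    IsManifold 𝓘(ℝ, Model d k) ∞ (freeShapes d k) ∧
    SecondCountableTopology (freeShapes d k) ∧
    ∃ U : Opens (freeShapes d k), Subtype.val '' (U : Set (freeShapes d k)) = S ∧
      IsManifold 𝓘(ℝ, Model d k) ∞ U ∧ T2Space U ∧ SecondCountableTopology U

end ProjShape

namespace ProjShape

open Module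

-- Everything is lifted to matrices of homogeneous coordinates, whose map to shapes is an open
-- quotient map; two matrices have the same shape iff an invertible matrix together with row
-- scalings relates them.
--
-- The numerical condition enters by counting. Let U and W be nonzero subspaces of complementary
-- dimensions, P and Q bounded. Then P has at most n_i landmarks in U and Q at most n_{rev i} in W,
-- so some l has P_l ∉ U and Q_l ∉ W (`IsBounded.not_forall_mem_or_mem`). For an eigenspace of a
-- non-scalar matrix fixing P and a complement containing the other eigenspaces, this yields
-- freeness. For the kernel and range of a singular nonzero matrix, it shows that limits of
-- projectivities between bounded configurations stay invertible; by compactness of the unit sphere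
-- of matrices the shape relation is closed, so the quotient is Hausdorff.
--
-- If n_i + n_{rev i} ≥ k, landmarks in general position can be distributed over two complementary
-- coordinate subspaces without violating the bounds. Scaling one subspace fixes this configuration,
-- so it is not free. Moving one landmark by t out of its subspace gives the same shape for all t ≠
-- 0, and this constant family converges to a different shape at t = 0: the space is not Hausdorff.
--
-- Boundedness is an open condition, so for the submanifold statement only charts of the free shapes
-- are missing. Once d + 1 independent landmarks are moved to the standard basis, only diagonal
-- matrices and row scalings remain. Freeness makes the bipartite graph of nonzero coefficients
-- connected; setting the entries on a spanning tree to 1 uses up the remaining freedom, and the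
-- other d(k - d - 2) entries are coordinates.

theorem exists_submodule_finrank_eq {V : Type*} [AddCommGroup V] [Module ℝ V]
    [FiniteDimensional ℝ V] (W : Submodule ℝ V) {m : ℕ} (h₁ : finrank ℝ W ≤ m)
    (h₂ : m ≤ finrank ℝ V) : ∃ S : Submodule ℝ V, W ≤ S ∧ finrank ℝ S = m := by
  induction m, h₁ using Nat.le_induction with
  | base => exact ⟨W, le_rfl, rfl⟩
  | succ m _ ih =>
    obtain ⟨S, hWS, hS⟩ := ih (by omega)
    obtain ⟨v, hv⟩ : ∃ v, v ∉ S := by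
      by_contra! h
      have : S = ⊤ := by ext; simp [h]
      rw [this, finrank_top] at hS
      omega
    refine ⟨S ⊔ Submodule.span ℝ {v}, hWS.trans le_sup_left, ?_⟩
    have hv0 : v ≠ 0 := fun h => hv (h ▸ S.zero_mem)
    have h := Submodule.finrank_sup_add_finrank_inf_eq S (Submodule.span ℝ {v})
    have hdisj : S ⊓ Submodule.span ℝ {v} = ⊥ :=
      ((Submodule.disjoint_span_singleton' hv0).2 hv).eq_bot
    rw [hdisj, finrank_bot, finrank_span_singleton hv0] at h
    omega

-- Homogeneous coordinates, shapes and free configurations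

variable {d k : ℕ}

/-- The configuration with given homogeneous coordinates. -/
noncomputable def toConfig (P : HomCoords d k) : Config d k :=
  fun l => Projectivization.mk ℝ (P.1 l) (P.2 l)

theorem isOpenQuotientMap_projectivizationMk (d : ℕ) :
    IsOpenQuotientMap fun v : {v : Fin (d + 1) → ℝ // v ≠ 0} =>
      (Projectivization.mk ℝ v.1 v.2 : RP d) where
  surjective p := by
    induction p using Projectivization.ind with
    | h v hv => exact ⟨⟨v, hv⟩, rfl⟩
  continuous := continuous_coinduced_rng
  isOpenMap U hU := by
    rw [isOpen_coinduced]
    -- The saturation of `U` is the union of its preimages under all nonzero scalings.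
    have : (fun v : {v : Fin (d + 1) → ℝ // v ≠ 0} => (Projectivization.mk ℝ v.1 v.2 : RP d)) ⁻¹'
        ((fun v : {v : Fin (d + 1) → ℝ // v ≠ 0} => Projectivization.mk ℝ v.1 v.2) '' U) =
        ⋃ c : ℝˣ, (fun v : {v : Fin (d + 1) → ℝ // v ≠ 0} =>
          (⟨(c : ℝ) • v.1, smul_ne_zero c.ne_zero v.2⟩ : {v : Fin (d + 1) → ℝ // v ≠ 0})) ⁻¹' U := by
      ext v
      simp only [Set.mem_preimage, Set.mem_image, Set.mem_iUnion, Projectivization.mk_eq_mk_iff]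
      constructor
      · rintro ⟨w, hw, c, hc⟩
        refine ⟨c, ?_⟩
        have : (⟨(c : ℝ) • v.1, smul_ne_zero c.ne_zero v.2⟩ : {v : Fin (d + 1) → ℝ // v ≠ 0}) = w :=
          Subtype.ext hc
        rwa [← this] at hw
      · rintro ⟨c, hc⟩
        exact ⟨_, hc, c, rfl⟩
    rw [this]
    exact isOpen_iUnion fun c => hU.preimage (by fun_prop)

instance : ContinuousConstSMul (PL d) (RP d) where
  continuous_const_smul g := by
    induction g using Matrix.ProjGenLinGroup.induction_on with
    | mk g =>
      rw [← (isOpenQuotientMap_projectivizationMk d).continuous_comp_iff]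
      have hc : Continuous fun v : {v : Fin (d + 1) → ℝ // v ≠ 0} =>
          (⟨g • v.1, (smul_ne_zero_iff_ne g).2 v.2⟩ : {v : Fin (d + 1) → ℝ // v ≠ 0}) :=
        Continuous.subtype_mk
          (Continuous.matrix_mulVec (continuous_const (y := g.1)) continuous_subtype_val) _
      exact (isOpenQuotientMap_projectivizationMk d).continuous.comp hc

/-- Homogeneous coordinates of a configuration, landmark by landmark. -/
def homCoordsHomeomorph (d k : ℕ) :
    HomCoords d k ≃ₜ (Fin k → {v : Fin (d + 1) → ℝ // v ≠ 0}) where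
  toFun P l := ⟨P.1 l, P.2 l⟩
  invFun v := ⟨fun l => (v l).1, fun l => (v l).2⟩
  left_inv _ := rfl
  right_inv _ := rfl
  continuous_toFun := by
    refine continuous_pi fun l => Continuous.subtype_mk ?_ _
    exact (continuous_apply l).comp continuous_subtype_val
  continuous_invFun := by
    refine Continuous.subtype_mk ?_ _
    exact continuous_pi fun l => continuous_subtype_val.comp (continuous_apply l)

theorem isOpenQuotientMap_toConfig : IsOpenQuotientMap (toConfig : HomCoords d k → Config d k) :=
  (IsOpenQuotientMap.piMap fun _ => isOpenQuotientMap_projectivizationMk d).comp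
    (homCoordsHomeomorph d k).isOpenQuotientMap

theorem isOpenQuotientMap_shape : IsOpenQuotientMap (shape : Config d k → ShapeSpace d k) :=
  MulAction.isOpenQuotientMap_quotientMk

theorem isOpenQuotientMap_shapeOfMatrix :
    IsOpenQuotientMap (shapeOfMatrix : HomCoords d k → ShapeSpace d k) :=
  isOpenQuotientMap_shape.comp isOpenQuotientMap_toConfig

instance : SecondCountableTopology (ShapeSpace d k) :=
  isOpenQuotientMap_shapeOfMatrix.isQuotientMap.secondCountableTopology
    isOpenQuotientMap_shapeOfMatrix.isOpenMap

/-- Two matrices of homogeneous coordinates describe the same shape. -/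
def SameShape (P Q : HomCoords d k) : Prop :=
  ∃ (A : GL (Fin (d + 1)) ℝ) (c : Fin k → ℝˣ), ∀ l, Q.1 l = (c l : ℝ) • (A.1.mulVec (P.1 l))

theorem toConfig_eq_smul_iff {P Q : HomCoords d k} {A : GL (Fin (d + 1)) ℝ} :
    (Matrix.ProjGenLinGroup.mk A : PL d) • toConfig P = toConfig Q ↔
      ∃ c : Fin k → ℝˣ, ∀ l, (c l : ℝ) • (Q.1 l) = A.1.mulVec (P.1 l) := by
  rw [funext_iff, ← Classical.skolem (p := fun l (c : ℝˣ) => (c : ℝ) • (Q.1 l) = A.1.mulVec (P.1 l))]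
  refine forall_congr' fun l => ?_
  rw [Pi.smul_apply, toConfig, toConfig, Projectivization.PGL.mk_smul_mk,
    Projectivization.mk_eq_mk_iff]
  rfl

theorem shapeOfMatrix_eq_iff {P Q : HomCoords d k} :
    shapeOfMatrix P = shapeOfMatrix Q ↔ SameShape P Q := by
  have : shapeOfMatrix P = shapeOfMatrix Q ↔ ∃ g : PL d, g • toConfig P = toConfig Q := by
    rw [eq_comm]
    exact Quotient.eq
  rw [this]
  constructor
  · rintro ⟨g, hg⟩
    induction g using Matrix.ProjGenLinGroup.induction_on with
    | mk A =>
      obtain ⟨c, hc⟩ := toConfig_eq_smul_iff.1 hg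
      refine ⟨A, fun l => (c l)⁻¹, fun l => ?_⟩
      rw [← hc, ← Units.smul_def, ← Units.smul_def, inv_smul_smul]
  · rintro ⟨A, c, hc⟩
    refine ⟨.mk A, toConfig_eq_smul_iff.2 ⟨fun l => (c l)⁻¹, fun l => ?_⟩⟩
    rw [hc, ← Units.smul_def, ← Units.smul_def, inv_smul_smul]

/-- Homogeneous coordinates of a free configuration. -/
def IsFree (P : HomCoords d k) : Prop :=
  ∀ (A : GL (Fin (d + 1)) ℝ) (c : Fin k → ℝˣ), (∀ l, A.1.mulVec (P.1 l) = (c l : ℝ) • P.1 l) →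
    ∃ a : ℝ, A.1 = Matrix.scalar _ a

theorem toConfig_mem_freeConfigs {P : HomCoords d k} :
    toConfig P ∈ freeConfigs d k ↔ IsFree P := by
  simp only [freeConfigs, Set.mem_ofPred_eq, Subgroup.eq_bot_iff_forall,
    MulAction.mem_stabilizer_iff]
  constructor
  · intro h A c hA
    have := h (.mk A) (toConfig_eq_smul_iff.2 ⟨c, fun l => (hA l).symm⟩)
    rw [Matrix.ProjGenLinGroup.mk_eq_one,
      Matrix.GeneralLinearGroup.mem_center_iff_val_mem_range_scalar] at this
    obtain ⟨a, ha⟩ := this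
    exact ⟨a, ha.symm⟩
  · intro h g hg
    induction g using Matrix.ProjGenLinGroup.induction_on with
    | mk A =>
      obtain ⟨c, hc⟩ := toConfig_eq_smul_iff.1 hg
      obtain ⟨a, ha⟩ := h A c fun l => (hc l).symm
      rw [Matrix.ProjGenLinGroup.mk_eq_one,
        Matrix.GeneralLinearGroup.mem_center_iff_val_mem_range_scalar]
      exact ⟨a, ha.symm⟩

theorem smul_mem_freeConfigs {p : Config d k} (hp : p ∈ freeConfigs d k) (g : PL d) :
    g • p ∈ freeConfigs d k := by
  simp only [freeConfigs, Set.mem_ofPred_eq] at hp ⊢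
  rw [MulAction.stabilizer_smul_eq_stabilizer_map_conj, hp, Subgroup.map_bot]

theorem shapeOfMatrix_mem_freeShapes {P : HomCoords d k} :
    shapeOfMatrix P ∈ freeShapes d k ↔ IsFree P := by
  rw [← toConfig_mem_freeConfigs]
  refine ⟨?_, fun h => ⟨_, h, rfl⟩⟩
  rintro ⟨p, hp, h⟩
  obtain ⟨g, hg⟩ : toConfig P ∈ MulAction.orbit (PL d) p := Quotient.exact h.symm
  rw [← hg]
  exact smul_mem_freeConfigs hp g

-- Bounded configurations: openness and freeness

/-- Homogeneous coordinates of a configuration bounded by the numbers `n`: a linear subspace of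
dimension `i + 1` contains at most `n i` landmarks. -/
def IsBounded (n : Fin d → ℕ) (P : HomCoords d k) : Prop :=
  ∀ (i : Fin d) (S : Submodule ℝ (Fin (d + 1) → ℝ)) (I : Finset (Fin k)),
    finrank ℝ S = i + 1 → (∀ l ∈ I, P.1 l ∈ S) → I.card ≤ n i

theorem toConfig_mem_boundedConfigs {n : Fin d → ℕ} (hn : ∀ i : Fin d, (i : ℕ) + 1 ≤ n i)
    {P : HomCoords d k} : toConfig P ∈ boundedConfigs k n ↔ IsBounded n P := by
  have hsub : ∀ (l : Fin k) (S : Submodule ℝ (Fin (d + 1) → ℝ)),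
      (toConfig P l).submodule ≤ S ↔ P.1 l ∈ S := fun l S => by
    rw [toConfig, Projectivization.submodule_mk, Submodule.span_singleton_le_iff_mem]
  constructor
  · intro h i S I hS hI
    by_cases hcard : (i : ℕ) + 1 ≤ I.card
    · exact h (I, i) ⟨hcard, S, hS, fun l hl => (hsub l S).2 (hI l hl)⟩
    · have := hn i
      omega
  · rintro h ⟨I, i⟩ ⟨-, S, hS, hI⟩
    exact h i S I hS fun l hl => (hsub l S).1 (hI l hl)

theorem SameShape.symm {P Q : HomCoords d k} (h : SameShape P Q) : SameShape Q P :=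
  shapeOfMatrix_eq_iff.1 (shapeOfMatrix_eq_iff.2 h).symm

theorem SameShape.isBounded {n : Fin d → ℕ} {P Q : HomCoords d k} (h : SameShape P Q)
    (hP : IsBounded n P) : IsBounded n Q := by
  intro i S I hS hI
  obtain ⟨A, c, hc⟩ := h
  have hA : Function.Injective A.1.mulVecLin := by
    rw [Matrix.coe_mulVecLin]
    exact Matrix.mulVec_injective_of_isUnit A.isUnit
  let e := LinearEquiv.ofInjectiveEndo A.1.mulVecLin hA
  refine hP i (S.comap (e : (Fin (d + 1) → ℝ) →ₗ[ℝ] (Fin (d + 1) → ℝ))) I ?_ fun l hl => ?_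
  · rw [Submodule.comap_equiv_eq_map_symm, ← hS]
    exact e.symm.finrank_map_eq S
  · have := S.smul_mem (c l : ℝ)⁻¹ (hI l hl)
    rw [hc, smul_smul, inv_mul_cancel₀ (c l).ne_zero, one_smul] at this
    exact this

theorem shapeOfMatrix_mem_boundedShapes {n : Fin d → ℕ} (hn : ∀ i : Fin d, (i : ℕ) + 1 ≤ n i)
    {P : HomCoords d k} : shapeOfMatrix P ∈ boundedShapes k n ↔ IsBounded n P := by
  refine ⟨?_, fun h => ⟨_, (toConfig_mem_boundedConfigs hn).2 h, rfl⟩⟩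
  rintro ⟨p, hp, h⟩
  obtain ⟨Q, rfl⟩ := isOpenQuotientMap_toConfig.surjective p
  exact (shapeOfMatrix_eq_iff.1 h).isBounded ((toConfig_mem_boundedConfigs hn).1 hp)

/-- More than `n i` landmarks may not fit into dimension `i + 1`, so they span at least `i + 2`
dimensions. In this form boundedness is visibly open, being a finite combination of linear
independence conditions. -/
theorem isBounded_iff_linearIndependent {n : Fin d → ℕ} {P : HomCoords d k} :
    IsBounded n P ↔ ∀ (i : Fin d) (I : Finset (Fin k)), n i < I.card →
      ∃ f : Fin (i + 2) → Fin k, (∀ t, f t ∈ I) ∧ LinearIndependent ℝ fun t => P.1 (f t) := by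
  constructor
  · intro h i I hI
    have hr : (i : ℕ) + 2 ≤ finrank ℝ (Submodule.span ℝ (P.1 '' I)) := by
      by_contra! hlt
      obtain ⟨S, hle, hS⟩ := exists_submodule_finrank_eq (Submodule.span ℝ (P.1 '' I))
        (m := i + 1) (by omega) (by rw [finrank_fin_fun]; omega)
      have := h i S I hS fun l hl => hle (Submodule.subset_span ⟨l, hl, rfl⟩)
      omega
    obtain ⟨f, hf, -, hli⟩ := Submodule.exists_fun_fin_finrank_span_eq ℝ (P.1 '' (I : Set (Fin k)))
    choose g hgI hg using hf
    refine ⟨fun t => g (Fin.castLE hr t), fun t => hgI _, ?_⟩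
    simp only [hg]
    exact hli.comp _ (Fin.castLE_injective hr)
  · intro h i S I hS hI
    by_contra! hlt
    obtain ⟨f, hfI, hf⟩ := h i I hlt
    have h₁ : Submodule.span ℝ (Set.range fun t => P.1 (f t)) ≤ S := by
      rw [Submodule.span_le]
      rintro _ ⟨t, rfl⟩
      exact hI _ (hfI t)
    have h₂ := Submodule.finrank_mono h₁
    rw [finrank_span_eq_card hf, Fintype.card_fin, hS] at h₂
    omega

theorem isOpen_isBounded (n : Fin d → ℕ) : IsOpen {P : HomCoords d k | IsBounded n P} := by
  simp only [isBounded_iff_linearIndependent, Set.ofPred_forall, Set.ofPred_exists]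
  refine isOpen_iInter_of_finite fun i => isOpen_iInter_of_finite fun I =>
    isOpen_iInter_of_finite fun _ => isOpen_iUnion fun f => ?_
  by_cases hf : ∀ t, f t ∈ I
  · simp only [hf, implies_true, true_and]
    exact isOpen_setOfPred_linearIndependent.preimage
      (f := fun P : HomCoords d k => fun t => P.1 (f t))
      (continuous_pi fun t => (continuous_apply (f t)).comp continuous_subtype_val)
  · simp [hf]

/-- Counting: with `i + 1 = dim U`, the dimension of `W` is `i.rev + 1`, so the two subspaces
account for at most `n i + n i.rev < k` landmarks. -/
theorem IsBounded.not_forall_mem_or_mem {n : Fin d → ℕ} (hn : ∀ i, n i + n i.rev < k)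
    {P Q : HomCoords d k} (hP : IsBounded n P) (hQ : IsBounded n Q)
    {U W : Submodule ℝ (Fin (d + 1) → ℝ)} (hU : U ≠ ⊥) (hW : W ≠ ⊥)
    (hUW : finrank ℝ U + finrank ℝ W = d + 1) : ¬ ∀ l, P.1 l ∈ U ∨ Q.1 l ∈ W := by
  classical
  intro h
  have hU' := Submodule.one_le_finrank_iff.2 hU
  have hW' := Submodule.one_le_finrank_iff.2 hW
  let i : Fin d := ⟨finrank ℝ U - 1, by omega⟩
  have h₁ := hP i U (Finset.univ.filter fun l => P.1 l ∈ U) (by simp only [i]; omega) (by simp)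
  have h₂ := hQ i.rev W (Finset.univ.filter fun l => Q.1 l ∈ W)
    (by simp only [i, Fin.val_rev]; omega) (by simp)
  have h₃ : (Finset.univ : Finset (Fin k)) ⊆
      (Finset.univ.filter fun l => P.1 l ∈ U) ∪ (Finset.univ.filter fun l => Q.1 l ∈ W) := by
    intro l _
    simpa using h l
  have h₄ := (Finset.card_le_card h₃).trans (Finset.card_union_le _ _)
  rw [Finset.card_univ, Fintype.card_fin] at h₄
  have := hn i
  omega

theorem IsBounded.isFree {n : Fin d → ℕ} (hn : ∀ i, n i + n i.rev < k) (hk : 0 < k)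
    {P : HomCoords d k} (hP : IsBounded n P) : IsFree P := by
  intro A c hA
  by_contra! hscalar
  let f : End ℝ (Fin (d + 1) → ℝ) := A.1.mulVecLin
  let μ : ℝ := c ⟨0, hk⟩
  have hmem : ∀ l, P.1 l ∈ f.eigenspace (c l) := fun l => End.mem_eigenspace_iff.2 (hA l)
  have hdisj := f.eigenspaces_iSupIndep μ
  -- Eigenspaces are independent, so the sum of those for eigenvalues other than `μ` extends to a
  -- complement `W` of the `μ`-eigenspace. Each landmark is an eigenvector and lies in one of the
  -- two.
  obtain ⟨W, hW₀, hW⟩ := hdisj.symm.exists_isCompl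
  have htop : f.eigenspace μ ≠ ⊤ := by
    intro h
    refine hscalar μ ?_
    refine Matrix.toLin'.injective (LinearMap.ext fun v => ?_)
    have hv : v ∈ f.eigenspace μ := h ▸ Submodule.mem_top
    have := End.mem_eigenspace_iff.1 hv
    simp only [f, Matrix.mulVecLin_apply] at this
    rw [Matrix.toLin'_apply, this, Matrix.toLin'_apply, Matrix.scalar_apply,
      ← Matrix.smul_one_eq_diagonal, Matrix.smul_mulVec, Matrix.one_mulVec]
  refine hP.not_forall_mem_or_mem hn hP (U := f.eigenspace μ) (W := W) ?_ ?_ ?_ fun l => ?_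
  · intro h
    have := hmem ⟨0, hk⟩
    rw [show ((c ⟨0, hk⟩ : ℝˣ) : ℝ) = μ from rfl, h] at this
    exact P.2 _ ((Submodule.mem_bot ℝ).1 this)
  · rintro rfl
    exact htop (by simpa using hW.sup_eq_top)
  · rw [add_comm, Submodule.finrank_add_eq_of_isCompl hW, finrank_fin_fun]
  · by_cases hl : (c l : ℝ) = μ
    · exact Or.inl (hl ▸ hmem l)
    · exact Or.inr (hW₀ ((le_iSup₂_of_le (f := fun (j : ℝ) (_ : j ≠ μ) => f.eigenspace j)
        (c l : ℝ) hl le_rfl) (hmem l)))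

-- Closedness of the shape relation and the Hausdorff property

/-- The pairs of matrices whose rows are related by a nonzero, possibly singular, matrix. -/
def degenerateRel (d k : ℕ) :
    Set ((Fin k → Fin (d + 1) → ℝ) × (Fin k → Fin (d + 1) → ℝ)) :=
  {q | ∃ A ∈ Metric.sphere (0 : Fin (d + 1) → Fin (d + 1) → ℝ) 1, ∀ l i j,
    (Matrix.of A).mulVec (q.1 l) i * q.2 l j = (Matrix.of A).mulVec (q.1 l) j * q.2 l i}

/-- Projecting along the compact unit sphere of matrices is a closed map, and the vanishing of the 2
× 2 minors of `A P_l` and `Q_l` is a closed condition. -/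
theorem isClosed_degenerateRel : IsClosed (degenerateRel d k) := by
  let T : Set (Metric.sphere (0 : Fin (d + 1) → Fin (d + 1) → ℝ) 1 ×
      ((Fin k → Fin (d + 1) → ℝ) × (Fin k → Fin (d + 1) → ℝ))) :=
    {r | ∀ l i j, (Matrix.of r.1.1).mulVec (r.2.1 l) i * r.2.2 l j =
      (Matrix.of r.1.1).mulVec (r.2.1 l) j * r.2.2 l i}
  have hT : IsClosed T := by
    have hA : ∀ i j, Continuous fun x : Metric.sphere (0 : Fin (d + 1) → Fin (d + 1) → ℝ) 1 ×
        ((Fin k → Fin (d + 1) → ℝ) × (Fin k → Fin (d + 1) → ℝ)) => x.1.1 i j := fun i j =>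
      (continuous_apply_apply i j).comp (continuous_subtype_val.comp continuous_fst)
    simp only [T, Set.ofPred_forall, Matrix.mulVec, dotProduct, Matrix.of_apply]
    refine isClosed_iInter fun l => isClosed_iInter fun i => isClosed_iInter fun j =>
      isClosed_eq ?_ ?_ <;>
    exact (continuous_finsetSum _ fun m _ => (hA _ m).mul (by fun_prop)).mul (by fun_prop)
  have : degenerateRel d k = Prod.snd '' T := by
    ext q
    constructor
    · rintro ⟨A, hA, h⟩
      exact ⟨(⟨A, hA⟩, q), h, rfl⟩
    · rintro ⟨⟨⟨A, hA⟩, q⟩, h, rfl⟩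
      exact ⟨A, hA, h⟩
  rw [this]
  exact isClosedMap_snd_of_compactSpace _ hT

theorem SameShape.mem_degenerateRel (hk : 0 < k) {P Q : HomCoords d k} (h : SameShape P Q) :
    (P.1, Q.1) ∈ degenerateRel d k := by
  obtain ⟨A, c, hc⟩ := h
  let B : Fin (d + 1) → Fin (d + 1) → ℝ := Matrix.of.symm A.1
  have hB : B ≠ 0 := by
    intro h0
    have hA0 : A.1 = 0 := h0
    refine Q.2 ⟨0, hk⟩ ?_
    rw [hc, hA0, Matrix.zero_mulVec, smul_zero]
  refine ⟨‖B‖⁻¹ • B, ?_, fun l i j => ?_⟩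
  · simp [norm_smul, hB]
  · have hof : Matrix.of (‖B‖⁻¹ • B) = ‖B‖⁻¹ • A.1 := rfl
    simp only [hof, Matrix.smul_mulVec, hc, Pi.smul_apply, smul_eq_mul]
    ring

/-- If `A` were singular, each landmark would satisfy `P_l ∈ ker A` or `Q_l ∈ range A`, which the
counting argument excludes. -/
theorem sameShape_of_mem_degenerateRel {n : Fin d → ℕ} (hn : ∀ i, n i + n i.rev < k)
    {P Q : HomCoords d k} (hP : IsBounded n P) (hQ : IsBounded n Q)
    (h : (P.1, Q.1) ∈ degenerateRel d k) : SameShape P Q := by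
  obtain ⟨B, hB, h⟩ := h
  let A : Matrix (Fin (d + 1)) (Fin (d + 1)) ℝ := Matrix.of B
  have hA0 : A ≠ 0 := by
    intro h0
    have : B = 0 := h0
    simp [this] at hB
  have hpar : ∀ l, A.mulVec (P.1 l) ≠ 0 → ∃ c : ℝˣ, Q.1 l = (c : ℝ) • A.mulVec (P.1 l) := by
    intro l hl
    obtain ⟨i, hi⟩ := Function.ne_iff.1 hl
    have hi' : A.mulVec (P.1 l) i ≠ 0 := hi
    have hQl : Q.1 l = (Q.1 l i / A.mulVec (P.1 l) i) • A.mulVec (P.1 l) := by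
      ext j
      have := h l i j
      change A.mulVec (P.1 l) i * Q.1 l j = A.mulVec (P.1 l) j * Q.1 l i at this
      rw [Pi.smul_apply, smul_eq_mul]
      field_simp
      linarith
    refine ⟨Units.mk0 _ fun h0 => Q.2 l ?_, hQl⟩
    rw [hQl, h0, zero_smul]
  by_cases hdet : A.det = 0
  · exfalso
    refine hP.not_forall_mem_or_mem hn hQ (U := A.mulVecLin.ker) (W := A.mulVecLin.range)
      ?_ ?_ ?_ fun l => ?_
    · obtain ⟨v, hv, hAv⟩ := Matrix.exists_mulVec_eq_zero_iff.2 hdet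
      exact Submodule.ne_bot_iff _ |>.2 ⟨v, hAv, hv⟩
    · rw [Ne, LinearMap.range_eq_bot]
      intro h0
      exact hA0 (Matrix.toLin'.injective (by rw [map_zero]; exact h0))
    · rw [add_comm, LinearMap.finrank_range_add_finrank_ker, finrank_fin_fun]
    · by_cases hl : A.mulVec (P.1 l) = 0
      · exact Or.inl hl
      · obtain ⟨c, hc⟩ := hpar l hl
        rw [hc]
        exact Or.inr (Submodule.smul_mem _ _ ⟨P.1 l, rfl⟩)
  · have hne : ∀ l, A.mulVec (P.1 l) ≠ 0 := fun l hl =>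
      P.2 l (Matrix.eq_zero_of_mulVec_eq_zero hdet hl)
    choose c hc using fun l => hpar l (hne l)
    exact ⟨Matrix.GeneralLinearGroup.mkOfDetNeZero A hdet, c, hc⟩

theorem t2Space_boundedShapes {n : Fin d → ℕ} (hn' : ∀ i : Fin d, (i : ℕ) + 1 ≤ n i)
    (hn : ∀ i, n i + n i.rev < k) (hk : 0 < k) : T2Space (boundedShapes k n) := by
  rw [t2Space_iff_of_isOpenQuotientMap
    (isOpenQuotientMap_shapeOfMatrix.restrictPreimage (boundedShapes k n))]
  have : {q : (shapeOfMatrix ⁻¹' boundedShapes k n) × (shapeOfMatrix ⁻¹' boundedShapes k n) |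
      (boundedShapes k n).restrictPreimage shapeOfMatrix q.1 =
        (boundedShapes k n).restrictPreimage shapeOfMatrix q.2} =
      (fun q => (q.1.1.1, q.2.1.1)) ⁻¹' degenerateRel d k := by
    ext ⟨⟨P, hP⟩, ⟨Q, hQ⟩⟩
    have hP' := (shapeOfMatrix_mem_boundedShapes hn').1 hP
    have hQ' := (shapeOfMatrix_mem_boundedShapes hn').1 hQ
    simp only [Set.mem_ofPred_eq, Set.mem_preimage, Subtype.ext_iff, Set.restrictPreimage_coe,
      shapeOfMatrix_eq_iff]
    exact ⟨fun h => h.mem_degenerateRel hk, sameShape_of_mem_degenerateRel hn hP' hQ'⟩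
  rw [this]
  exact isClosed_degenerateRel.preimage (by fun_prop)

theorem isOpen_boundedShapes {n : Fin d → ℕ} (hn : ∀ i : Fin d, (i : ℕ) + 1 ≤ n i) :
    IsOpen (boundedShapes k n) := by
  rw [← isOpenQuotientMap_shapeOfMatrix.isQuotientMap.isOpen_preimage]
  convert isOpen_isBounded n using 1
  ext P
  exact shapeOfMatrix_mem_boundedShapes hn

-- Split configurations as counterexamples

/-- The point with parameter `x` of the moment curve in the coordinates `o ≤ s < o + a`. -/
def momentVec (d o a : ℕ) (x : ℝ) : Fin (d + 1) → ℝ :=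
  fun s => if o ≤ (s : ℕ) ∧ (s : ℕ) < o + a then x ^ ((s : ℕ) - o) else 0

/-- The span of the coordinate vectors with indices `o ≤ s < o + a`. -/
def coordSubspace (d o a : ℕ) : Submodule ℝ (Fin (d + 1) → ℝ) where
  carrier := {v | ∀ s : Fin (d + 1), ¬ (o ≤ (s : ℕ) ∧ (s : ℕ) < o + a) → v s = 0}
  add_mem' hv hw s hs := by rw [Pi.add_apply, hv s hs, hw s hs, add_zero]
  zero_mem' _ _ := rfl
  smul_mem' c v hv s hs := by rw [Pi.smul_apply, hv s hs, smul_zero]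

theorem momentVec_mem_coordSubspace (d o a : ℕ) (x : ℝ) :
    momentVec d o a x ∈ coordSubspace d o a := fun _ hs => if_neg hs

theorem linearIndependent_momentVec {o a c : ℕ} (hoa : o + a ≤ d + 1) (hc : c ≤ a)
    {f : Fin c → ℝ} (hf : Function.Injective f) :
    LinearIndependent ℝ fun t => momentVec d o a (f t) := by
  refine LinearIndependent.of_comp
    (LinearMap.funLeft ℝ ℝ fun j : Fin c => (⟨o + j, by omega⟩ : Fin (d + 1))) ?_
  have : (LinearMap.funLeft ℝ ℝ fun j : Fin c => (⟨o + j, by omega⟩ : Fin (d + 1))) ∘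
      (fun t => momentVec d o a (f t)) = (Matrix.vandermonde f).row := by
    ext t j
    simp only [Function.comp_apply, LinearMap.funLeft_apply, momentVec, Matrix.row_apply,
      Matrix.vandermonde_apply]
    rw [if_pos ⟨by omega, by omega⟩, Nat.add_sub_cancel_left]
  rw [this]
  exact Matrix.linearIndependent_rows_of_det_ne_zero (Matrix.det_vandermonde_ne_zero_iff.2 hf)

/-- General position on the moment curve: by Vandermonde, up to `a` of its points are independent.
-/
theorem min_card_le_finrank_inf_coordSubspace {o a : ℕ} (hoa : o + a ≤ d + 1)
    (S : Submodule ℝ (Fin (d + 1) → ℝ)) {I : Finset ℝ} (hI : ∀ x ∈ I, momentVec d o a x ∈ S) :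
    min I.card a ≤ finrank ℝ ↥(S ⊓ coordSubspace d o a) := by
  obtain ⟨J, hJI, hJ⟩ := Finset.exists_subset_card_eq (min_le_left I.card a)
  let f : Fin (min I.card a) → ℝ := fun t => (J.equivFinOfCardEq hJ).symm t
  have hf : Function.Injective f :=
    Subtype.val_injective.comp (J.equivFinOfCardEq hJ).symm.injective
  have hli := linearIndependent_momentVec hoa (min_le_right I.card a) hf
  have hspan : Submodule.span ℝ (Set.range fun t => momentVec d o a (f t)) ≤
      S ⊓ coordSubspace d o a := by
    rw [Submodule.span_le]
    rintro _ ⟨t, rfl⟩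
    exact ⟨hI _ (hJI ((J.equivFinOfCardEq hJ).symm t).2), momentVec_mem_coordSubspace _ _ _ _⟩
  have := Submodule.finrank_mono hspan
  rwa [finrank_span_eq_card hli, Fintype.card_fin] at this

theorem disjoint_coordSubspace (d a b : ℕ) :
    Disjoint (coordSubspace d 0 a) (coordSubspace d a b) := by
  rw [Submodule.disjoint_def]
  intro v hv hw
  ext s
  by_cases hs : (s : ℕ) < a
  · exact hw s (by omega)
  · exact hv s (by omega)

theorem finrank_coordSubspace_le {a b : ℕ} (hab : a + b = d + 1) :
    finrank ℝ (coordSubspace d a b) ≤ b := by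
  have h₁ := min_card_le_finrank_inf_coordSubspace (d := d) (o := 0) (a := a) (by omega) ⊤
    (I := (Finset.range a).image Nat.cast) (fun _ _ => Submodule.mem_top)
  rw [Finset.card_image_of_injective _ Nat.cast_injective, Finset.card_range, min_self,
    top_inf_eq] at h₁
  have h₂ := Submodule.finrank_add_finrank_le_of_disjoint (disjoint_coordSubspace d a b)
  rw [finrank_fin_fun] at h₂
  omega

/-- Landmarks `l < m` on the moment curve of the first `a` coordinates, and landmarks `l ≥ m` on
the moment curve of the other coordinates, where the landmark `m` is moved by `t` in the first
coordinate direction. -/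
noncomputable def splitCoords (d k a m : ℕ) (ha : 1 ≤ a) (had : a ≤ d) (t : ℝ) : HomCoords d k :=
  ⟨fun l => if (l : ℕ) < m then momentVec d 0 a (l : ℕ) else
      momentVec d a (d + 1 - a) (l : ℕ) + Pi.single 0 (if (l : ℕ) = m then t else 0), fun l h => by
    have h' := congr_fun h
    by_cases hl : (l : ℕ) < m
    · have := h' 0
      simp only [if_pos hl, momentVec] at this
      -- The coordinate with exponent 0 equals 1 at every parameter, also for `l = 0` since `0 ^ 0 =
      -- 1`.
      rw [if_pos ⟨by simp, by simp; omega⟩] at this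
      simp at this
    · have := h' ⟨a, by omega⟩
      simp only [if_neg hl, momentVec, Pi.add_apply, Pi.zero_apply] at this
      rw [if_pos ⟨le_rfl, by omega⟩, Pi.single_eq_of_ne (by
        intro h0
        have := congr_arg Fin.val h0
        simp at this
        omega)] at this
      simp at this⟩

section

variable {a m : ℕ} {ha : 1 ≤ a} {had : a ≤ d}

theorem splitCoords_of_lt {t : ℝ} {l : Fin k} (hl : (l : ℕ) < m) :
    (splitCoords d k a m ha had t).1 l = momentVec d 0 a (l : ℕ) := if_pos hl

theorem splitCoords_of_not_lt {t : ℝ} {l : Fin k} (hl : ¬ (l : ℕ) < m) :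
    (splitCoords d k a m ha had t).1 l = momentVec d a (d + 1 - a) (l : ℕ) +
      Pi.single 0 (if (l : ℕ) = m then t else 0) := if_neg hl

theorem continuous_splitCoords : Continuous (splitCoords d k a m ha had) := by
  refine Continuous.subtype_mk (continuous_pi fun l => ?_) _
  by_cases hl : (l : ℕ) < m
  · simp only [if_pos hl]
    exact continuous_const
  · simp only [if_neg hl]
    by_cases hm : (l : ℕ) = m
    · simp only [if_pos hm]
      exact continuous_const.add
        (LinearMap.single ℝ (fun _ : Fin (d + 1) => ℝ) 0).continuous_of_finiteDimensional
    · simp only [if_neg hm]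
      exact continuous_const

/-- The projectivity scaling the first `a` coordinates by `t`. -/
noncomputable def scaleFirst (d a : ℕ) (t : ℝ) (ht : t ≠ 0) : GL (Fin (d + 1)) ℝ :=
  Matrix.GeneralLinearGroup.mkOfDetNeZero
    (Matrix.diagonal fun s : Fin (d + 1) => if (s : ℕ) < a then t else 1) (by
      rw [Matrix.det_diagonal, Finset.prod_ne_zero_iff]
      intro s _
      split_ifs
      · exact ht
      · exact one_ne_zero)

theorem scaleFirst_mulVec {t : ℝ} (ht : t ≠ 0) (v : Fin (d + 1) → ℝ) (s : Fin (d + 1)) :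
    (scaleFirst d a t ht).1.mulVec v s = (if (s : ℕ) < a then t else 1) * v s := by
  exact Matrix.mulVec_diagonal _ _ _

/-- Landmarks `l < m` are only rescaled, while the displacement of landmark `m` is multiplied by
`t`. Thus all nonzero displacements give one shape, and displacement 0 has nontrivial isotropy. -/
theorem scaleFirst_splitCoords (ha : 1 ≤ a) (had : a ≤ d) {t r : ℝ} (ht : t ≠ 0) (l : Fin k) :
    (scaleFirst d a t ht).1.mulVec ((splitCoords d k a m ha had r).1 l) =
      (if (l : ℕ) < m then t else 1) • (splitCoords d k a m ha had (t * r)).1 l := by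
  ext s
  rw [scaleFirst_mulVec]
  by_cases hl : (l : ℕ) < m
  · rw [splitCoords_of_lt hl, splitCoords_of_lt hl, if_pos hl, Pi.smul_apply, smul_eq_mul,
      momentVec]
    by_cases hs : (s : ℕ) < a
    · rw [if_pos hs]
    · rw [if_neg hs, if_neg (by omega)]
      simp
  · rw [splitCoords_of_not_lt hl, splitCoords_of_not_lt hl, if_neg hl, one_smul, Pi.add_apply,
      Pi.add_apply, momentVec]
    by_cases hs : (s : ℕ) < a
    · rw [if_pos hs, if_neg (by omega)]
      by_cases h0 : s = 0
      · subst h0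
        simp
      · simp [h0]
    · have h0 : s ≠ 0 := by
        rintro rfl
        simp at hs
        omega
      simp [hs, h0]

theorem sameShape_splitCoords {t : ℝ} (ht : t ≠ 0) :
    SameShape (splitCoords d k a m ha had 1) (splitCoords d k a m ha had t) := by
  refine ⟨scaleFirst d a t ht, fun l => if (l : ℕ) < m then (Units.mk0 t ht)⁻¹ else 1, fun l => ?_⟩
  rw [scaleFirst_splitCoords, mul_one, smul_smul]
  by_cases hl : (l : ℕ) < m
  · simp [hl, ht]
  · simp [hl]

theorem not_isFree_splitCoords : ¬ IsFree (splitCoords d k a m ha had 0) := by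
  intro h
  obtain ⟨r, hr⟩ := h (scaleFirst d a 2 two_ne_zero)
    (fun l => if (l : ℕ) < m then Units.mk0 2 two_ne_zero else 1) fun l => by
      rw [scaleFirst_splitCoords, mul_zero]
      by_cases hl : (l : ℕ) < m
      · simp [hl]
      · simp [hl]
  -- Coordinates 0 and `a` of the image of the all-ones vector would give `r = 2` and `r = 1`.
  have h := fun s => congr_fun (congr_arg (fun M => M.mulVec 1) hr) s
  simp only [scaleFirst_mulVec, Matrix.scalar_apply, Matrix.mulVec_diagonal] at h
  have h₁ := h 0
  have h₂ := h ⟨a, by omega⟩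
  rw [if_pos (by simp; omega)] at h₁
  rw [if_neg (by simp)] at h₂
  simp only [Pi.one_apply, mul_one] at h₁ h₂
  linarith

theorem splitCoords_mem_coordSubspace {l : Fin k} (hl : ¬ (l : ℕ) < m) :
    (splitCoords d k a m ha had 0).1 l ∈ coordSubspace d a (d + 1 - a) := by
  rw [splitCoords_of_not_lt hl]
  simpa using momentVec_mem_coordSubspace _ _ _ _

/-- A projectivity `A` would put all displaced landmarks `l ≥ m` into the image `S` of `W`. Those
with `l > m` already span `W` by `hm`, so `S = W`; but the displaced landmark `m` is outside `W`. -/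
theorem not_sameShape_splitCoords (hm : m + (d + 1 - a) < k) :
    ¬ SameShape (splitCoords d k a m ha had 0) (splitCoords d k a m ha had 1) := by
  rintro ⟨A, c, hc⟩
  let W := coordSubspace d a (d + 1 - a)
  let S := W.map A.1.mulVecLin
  have hmem : ∀ l : Fin k, ¬ (l : ℕ) < m → (splitCoords d k a m ha had 1).1 l ∈ S := fun l hl => by
    rw [hc]
    exact S.smul_mem _ ⟨_, splitCoords_mem_coordSubspace hl, rfl⟩
  have h₁ := min_card_le_finrank_inf_coordSubspace (d := d) (o := a) (a := d + 1 - a) (by omega) S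
    (I := (Finset.Ioo m k).image Nat.cast) (by
      intro x hx
      obtain ⟨l, hl, rfl⟩ := Finset.mem_image.1 hx
      rw [Finset.mem_Ioo] at hl
      have := hmem ⟨l, hl.2⟩ (by simp; omega)
      rw [splitCoords_of_not_lt (by simp; omega)] at this
      simpa [hl.1.ne'] using this)
  rw [Finset.card_image_of_injective _ Nat.cast_injective, Nat.card_Ioo, min_eq_right (by omega)]
    at h₁
  change _ ≤ finrank ℝ ↥(S ⊓ W) at h₁
  have hW : finrank ℝ W ≤ d + 1 - a := finrank_coordSubspace_le (by omega)
  have hS : finrank ℝ S ≤ finrank ℝ W := Submodule.finrank_map_le _ _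
  have h₂ : S ⊓ W = S := Submodule.eq_of_le_of_finrank_le inf_le_left (by omega)
  have h₃ : (splitCoords d k a m ha had 1).1 ⟨m, by omega⟩ ∈ W := by
    have := hmem ⟨m, by omega⟩ (by simp)
    rw [← h₂] at this
    exact this.2
  have h₄ := h₃ 0 (by simp; omega)
  rw [splitCoords_of_not_lt (by simp), Pi.add_apply,
    momentVec_mem_coordSubspace _ _ _ _ 0 (by simp; omega)] at h₄
  simp at h₄

theorem isBounded_splitCoords {n : Fin d → ℕ} (hn' : ∀ i : Fin d, (i : ℕ) + 1 ≤ n i)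
    (hn : ∀ i j : Fin d, i ≤ j → n i + (j - i : ℕ) ≤ n j) {i : Fin d}
    (hm : m ≤ n i) (hm' : k ≤ m + n i.rev) :
    IsBounded n (splitCoords d k (i + 1) m (Nat.le_add_left _ _) i.2 0) := by
  classical
  intro j S I hS hI
  let a : ℕ := i + 1
  let I₁ := I.filter fun l : Fin k => (l : ℕ) < m
  let I₂ := I.filter fun l : Fin k => ¬ (l : ℕ) < m
  have hcard : I₁.card + I₂.card = I.card :=
    Finset.card_filter_add_card_filter_not (s := I) fun l => (l : ℕ) < m
  have hinj : Function.Injective fun l : Fin k => ((l : ℕ) : ℝ) :=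
    Nat.cast_injective.comp Fin.val_injective
  have h₁ := min_card_le_finrank_inf_coordSubspace (d := d) (o := 0) (a := a) (by omega) S
    (I := I₁.image fun l : Fin k => ((l : ℕ) : ℝ)) (by
      intro x hx
      obtain ⟨l, hl, rfl⟩ := Finset.mem_image.1 hx
      obtain ⟨hlI, hl⟩ := Finset.mem_filter.1 hl
      have := hI l hlI
      rwa [splitCoords_of_lt hl] at this)
  have h₂ := min_card_le_finrank_inf_coordSubspace (d := d) (o := a) (a := d + 1 - a) (by omega) S
    (I := I₂.image fun l : Fin k => ((l : ℕ) : ℝ)) (by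
      intro x hx
      obtain ⟨l, hl, rfl⟩ := Finset.mem_image.1 hx
      obtain ⟨hlI, hl⟩ := Finset.mem_filter.1 hl
      have := hI l hlI
      rw [splitCoords_of_not_lt hl] at this
      rwa [ite_self, Pi.single_zero, add_zero] at this)
  rw [Finset.card_image_of_injective _ hinj] at h₁ h₂
  have h₃ : finrank ℝ ↥(S ⊓ coordSubspace d 0 a) +
      finrank ℝ ↥(S ⊓ coordSubspace d a (d + 1 - a)) ≤ j + 1 := by
    have hd : Disjoint (S ⊓ coordSubspace d 0 a) (S ⊓ coordSubspace d a (d + 1 - a)) :=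
      (disjoint_coordSubspace d a _).mono inf_le_right inf_le_right
    have h := Submodule.finrank_sup_add_finrank_inf_eq
      (S ⊓ coordSubspace d 0 a) (S ⊓ coordSubspace d a (d + 1 - a))
    rw [hd.eq_bot, finrank_bot, add_zero] at h
    rw [← h, ← hS]
    exact Submodule.finrank_mono (sup_le inf_le_left inf_le_left)
  have h₄ : I₁.card ≤ m := by
    have : I₁.image Fin.val ⊆ Finset.range m := by
      intro x hx
      obtain ⟨l, hl, rfl⟩ := Finset.mem_image.1 hx
      exact Finset.mem_range.2 (Finset.mem_filter.1 hl).2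
    simpa [Finset.card_image_of_injective _ Fin.val_injective] using Finset.card_le_card this
  have h₅ : I₂.card ≤ k - m := by
    have : I₂.image Fin.val ⊆ Finset.Ico m k := by
      intro x hx
      obtain ⟨l, hl, rfl⟩ := Finset.mem_image.1 hx
      exact Finset.mem_Ico.2 ⟨not_lt.1 (Finset.mem_filter.1 hl).2, l.2⟩
    simpa [Finset.card_image_of_injective _ Fin.val_injective] using Finset.card_le_card this
  have hj := hn' j
  have hjd := j.2
  have hid := i.2
  have hrev := Fin.val_rev i
  -- If the first block fills its subspace, then, as `j + 1 ≤ d`, the second does not and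
  -- contributes at most `j - i` landmarks, so `|I| ≤ n i + (j - i) ≤ n j`. The other block is
  -- symmetric; if neither is filled, `|I| ≤ j + 1`.
  by_cases hc₁ : a ≤ I₁.card
  · rw [min_eq_right hc₁] at h₁
    have := hn i j (Fin.le_def.2 (by omega))
    omega
  · by_cases hc₂ : d + 1 - a ≤ I₂.card
    · rw [min_eq_right hc₂] at h₂
      have := hn i.rev j (Fin.le_def.2 (by omega))
      omega
    · omega

end

theorem exists_splitCoords {n : Fin d → ℕ} (hk : d + 3 ≤ k)
    (hn' : ∀ i : Fin d, (i : ℕ) + 1 ≤ n i)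
    (hn : ∀ i j : Fin d, i ≤ j → n i + (j - i : ℕ) ≤ n j) (h : ¬ ∀ i, n i + n i.rev < k) :
    ∃ (a m : ℕ) (ha : 1 ≤ a) (had : a ≤ d), m + (d + 1 - a) < k ∧
      IsBounded n (splitCoords d k a m ha had 0) := by
  push Not at h
  obtain ⟨i, hi⟩ := h
  have hid := i.2
  have hrev := Fin.val_rev i
  have h₁ := hn' i
  -- The block containing the moved landmark needs one landmark more than its dimension. If the
  -- second block is too small for this, `min (n i) k ≥ i + 3` because `k ≥ d + 3`, and the blocks
  -- exchange roles.
  by_cases hm : min (n i) k + (d - i) < k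
  · exact ⟨i + 1, min (n i) k, _, i.2, by omega,
      isBounded_splitCoords hn' hn (min_le_left _ _) (by omega)⟩
  · refine ⟨i.rev + 1, k - min (n i) k, _, i.rev.2, by omega,
      isBounded_splitCoords hn' hn (by omega) ?_⟩
    rw [Fin.rev_rev]
    omega

/-- By openness, small displacements keep the split configuration bounded, so their common shape is
in the space. It and the split shape are two distinct limits of one constant family. -/
theorem not_t2Space_boundedShapes {n : Fin d → ℕ} (hk : d + 3 ≤ k)
    (hn' : ∀ i : Fin d, (i : ℕ) + 1 ≤ n i)
    (hn : ∀ i j : Fin d, i ≤ j → n i + (j - i : ℕ) ≤ n j) (h : ¬ ∀ i, n i + n i.rev < k) :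
    ¬ T2Space (boundedShapes k n) := by
  intro hT2
  obtain ⟨a, m, ha, had, hm, hb⟩ := exists_splitCoords hk hn' hn h
  have hev : ∀ᶠ t in 𝓝 (0 : ℝ), IsBounded n (splitCoords d k a m ha had t) :=
    continuous_splitCoords.continuousAt.eventually_mem ((isOpen_isBounded n).mem_nhds hb)
  obtain ⟨t, htb, ht⟩ :=
    ((hev.filter_mono nhdsWithin_le_nhds).and (self_mem_nhdsWithin (s := {0}ᶜ))).exists
  have hb' := (sameShape_splitCoords (t := t) ht).symm.isBounded htb
  have hlim : Filter.Tendsto (fun _ : ℝ => (⟨_, (shapeOfMatrix_mem_boundedShapes hn').2 hb'⟩ :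
      boundedShapes k n)) (𝓝[≠] 0) (𝓝 ⟨_, (shapeOfMatrix_mem_boundedShapes hn').2 hb⟩) := by
    rw [tendsto_subtype_rng]
    have := ((isOpenQuotientMap_shapeOfMatrix.continuous.comp
      (continuous_splitCoords (k := k) (m := m) (ha := ha) (had := had))).tendsto 0).mono_left
        (nhdsWithin_le_nhds (s := {0}ᶜ))
    refine this.congr' ?_
    filter_upwards [self_mem_nhdsWithin] with t ht
    exact (shapeOfMatrix_eq_iff.2 (sameShape_splitCoords ht)).symm
  have := tendsto_nhds_unique hlim tendsto_const_nhds
  exact not_sameShape_splitCoords hm (shapeOfMatrix_eq_iff.1 (Subtype.ext_iff.1 this))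

theorem not_boundedShapes_subset_freeShapes {n : Fin d → ℕ} (hk : d + 3 ≤ k)
    (hn' : ∀ i : Fin d, (i : ℕ) + 1 ≤ n i)
    (hn : ∀ i j : Fin d, i ≤ j → n i + (j - i : ℕ) ≤ n j) (h : ¬ ∀ i, n i + n i.rev < k) :
    ¬ boundedShapes k n ⊆ freeShapes d k := by
  intro hsub
  obtain ⟨a, m, ha, had, -, hb⟩ := exists_splitCoords hk hn' hn h
  exact not_isFree_splitCoords
    (shapeOfMatrix_mem_freeShapes.1 (hsub ((shapeOfMatrix_mem_boundedShapes hn').2 hb)))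

-- Spanning trees and normalization of matrices

variable {L : Type*}

/-- A spanning tree of the complete bipartite graph between `Fin (d + 1)` and `L`, rooted at
`0 : Fin (d + 1)`: every other vertex has a parent of smaller height. -/
structure SpanningTree (d : ℕ) (L : Type*) where
  colParent : Fin (d + 1) → L
  rowParent : L → Fin (d + 1)
  colHeight : Fin (d + 1) → ℕ
  rowHeight : L → ℕ
  col_lt : ∀ j, j ≠ 0 → rowHeight (colParent j) < colHeight j
  row_lt : ∀ l, colHeight (rowParent l) < rowHeight l

namespace SpanningTree

variable (T : SpanningTree d L)

/-- The edges of the tree. -/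
def IsEdge (l : L) (j : Fin (d + 1)) : Prop := T.rowParent l = j ∨ j ≠ 0 ∧ T.colParent j = l

theorem isEdge_rowParent (l : L) : T.IsEdge l (T.rowParent l) := Or.inl rfl

theorem isEdge_colParent {j : Fin (d + 1)} (hj : j ≠ 0) : T.IsEdge (T.colParent j) j :=
  Or.inr ⟨hj, rfl⟩

theorem induction {p : Fin (d + 1) → Prop} {q : L → Prop} (root : p 0)
    (row : ∀ l, p (T.rowParent l) → q l) (col : ∀ j, j ≠ 0 → q (T.colParent j) → p j) :
    (∀ j, p j) ∧ ∀ l, q l := by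
  have key : ∀ N, (∀ j, T.colHeight j < N → p j) ∧ ∀ l, T.rowHeight l < N → q l := by
    intro N
    induction N with
    | zero => exact ⟨fun _ h => absurd h (Nat.not_lt_zero _), fun _ h => absurd h (Nat.not_lt_zero _)⟩
    | succ N ih =>
      refine ⟨fun j hj => ?_, fun l hl => row l (ih.1 _ ?_)⟩
      · by_cases h0 : j = 0
        · exact h0 ▸ root
        · exact col j h0 (ih.2 _ (by have := T.col_lt j h0; omega))
      · have := T.row_lt l
        omega
  exact ⟨fun j => (key _).1 j (Nat.lt_succ_self _), fun l => (key _).2 l (Nat.lt_succ_self _)⟩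

/-- A tree on `d + 1 + |L|` vertices has `d + |L|` edges: every vertex but the root contributes the
edge to its parent. -/
theorem card_not_isEdge [Fintype L] [Fintype {e : L × Fin (d + 1) // ¬ T.IsEdge e.1 e.2}] :
    Fintype.card {e : L × Fin (d + 1) // ¬ T.IsEdge e.1 e.2} = d * (Fintype.card L - 1) := by
  classical
  let R : Finset (L × Fin (d + 1)) := Finset.univ.image fun l => (l, T.rowParent l)
  let S : Finset (L × Fin (d + 1)) := (Finset.univ.erase 0).image fun j => (T.colParent j, j)
  have hR : R.card = Fintype.card L :=
    Finset.card_image_of_injective _ fun l l' h => congr_arg Prod.fst h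
  have hS : S.card = d := by
    have : S.card = (Finset.univ.erase (0 : Fin (d + 1))).card :=
      Finset.card_image_of_injective _ fun l l' h => congr_arg Prod.snd h
    rw [this, Finset.card_erase_of_mem (Finset.mem_univ _), Finset.card_univ, Fintype.card_fin,
      Nat.add_sub_cancel]
  -- A common edge would make each endpoint the parent of the other, contradicting the heights.
  have hRS : Disjoint R S := by
    rw [Finset.disjoint_left]
    rintro ⟨l, j⟩ h₁ h₂
    simp only [R, S, Finset.mem_image, Finset.mem_univ, true_and, Prod.mk.injEq,
      Finset.mem_erase, and_true] at h₁ h₂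
    obtain ⟨l', rfl, h₁⟩ := h₁
    obtain ⟨j', hj, h₂, rfl⟩ := h₂
    have h₃ := T.row_lt l'
    have h₄ := T.col_lt j' hj
    rw [h₁] at h₃
    rw [h₂] at h₄
    omega
  have hedge : Fintype.card {e : L × Fin (d + 1) // T.IsEdge e.1 e.2} = Fintype.card L + d := by
    trans R.card + S.card
    swap
    · rw [hR, hS]
    rw [Fintype.card_subtype, ← Finset.card_union_of_disjoint hRS]
    congr 1
    ext ⟨l, j⟩
    rw [Finset.mem_filter]
    simp only [IsEdge, R, S, Finset.mem_univ, true_and, Finset.mem_union,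
      Finset.mem_image, Prod.mk.injEq, Finset.mem_erase, and_true]
    constructor
    · rintro (h | ⟨h₀, h⟩)
      · exact Or.inl ⟨l, rfl, h⟩
      · exact Or.inr ⟨j, h₀, h, rfl⟩
    · rintro (⟨_, rfl, h⟩ | ⟨_, h₀, h, rfl⟩)
      · exact Or.inl h
      · exact Or.inr ⟨h₀, h⟩
  have h := Fintype.card_subtype_compl fun e : L × Fin (d + 1) => T.IsEdge e.1 e.2
  have hconv : Fintype.card {e : L × Fin (d + 1) // ¬ T.IsEdge e.1 e.2} =
      Fintype.card (L × Fin (d + 1)) - (Fintype.card L + d) := by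
    rw [← hedge, ← h]
  rw [hconv, Fintype.card_prod, Fintype.card_fin]
  -- The value `colParent 0` is meaningless for the root, but witnesses that `L` is nonempty.
  have hpos : 0 < Fintype.card L := Fintype.card_pos_iff.2 ⟨T.colParent 0⟩
  obtain ⟨c, hc⟩ := Nat.exists_eq_add_of_lt hpos
  rw [hc, zero_add, Nat.add_sub_cancel]
  have : (c + 1) * (d + 1) = d * c + (c + 1 + d) := by ring
  omega

mutual

/-- The factors by which the rows of `C` are scaled to turn the entries at the edges into `1`. -/
noncomputable def rowScale (C : L → Fin (d + 1) → ℝ) (l : L) : ℝ :=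
  (C l (T.rowParent l) * colScale C (T.rowParent l))⁻¹
termination_by T.rowHeight l
decreasing_by exact T.row_lt l

/-- The factors by which the columns of `C` are scaled to turn the entries at the edges into `1`. -/
noncomputable def colScale (C : L → Fin (d + 1) → ℝ) (j : Fin (d + 1)) : ℝ :=
  if _h : j = 0 then 1 else (C (T.colParent j) j * rowScale C (T.colParent j))⁻¹
termination_by T.colHeight j
decreasing_by exact T.col_lt j _h

end

theorem rowScale_eq (C : L → Fin (d + 1) → ℝ) (l : L) :
    T.rowScale C l = (C l (T.rowParent l) * T.colScale C (T.rowParent l))⁻¹ := by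
  rw [rowScale]

theorem colScale_zero (C : L → Fin (d + 1) → ℝ) : T.colScale C 0 = 1 := by
  rw [colScale, dif_pos rfl]

theorem colScale_eq (C : L → Fin (d + 1) → ℝ) {j : Fin (d + 1)} (hj : j ≠ 0) :
    T.colScale C j = (C (T.colParent j) j * T.rowScale C (T.colParent j))⁻¹ := by
  rw [colScale, dif_neg hj]

theorem scale_ne_zero {C : L → Fin (d + 1) → ℝ} (hC : ∀ l j, T.IsEdge l j → C l j ≠ 0) :
    (∀ j, T.colScale C j ≠ 0) ∧ ∀ l, T.rowScale C l ≠ 0 := by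
  refine T.induction ?_ (fun l hl => ?_) fun j hj hl => ?_
  · rw [colScale_zero]
    exact one_ne_zero
  · rw [rowScale_eq]
    exact inv_ne_zero (mul_ne_zero (hC _ _ (T.isEdge_rowParent l)) hl)
  · rw [colScale_eq _ _ hj]
    exact inv_ne_zero (mul_ne_zero (hC _ _ (T.isEdge_colParent hj)) hl)

theorem scale_eq_one {C : L → Fin (d + 1) → ℝ} (hC : ∀ l j, T.IsEdge l j → C l j = 1) :
    (∀ j, T.colScale C j = 1) ∧ ∀ l, T.rowScale C l = 1 := by
  refine T.induction (T.colScale_zero C) (fun l hl => ?_) fun j hj hl => ?_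
  · rw [rowScale_eq, hl, hC _ _ (T.isEdge_rowParent l), mul_one, inv_one]
  · rw [colScale_eq _ _ hj, hl, hC _ _ (T.isEdge_colParent hj), mul_one, inv_one]

/-- By recursion along the tree, the factors are rational in the entries, with denominators that
vanish nowhere as long as the edge entries do not. -/
theorem contDiffAt_scale [Fintype L] {C : L → Fin (d + 1) → ℝ}
    (hC : ∀ l j, T.IsEdge l j → C l j ≠ 0) :
    (∀ j, ContDiffAt ℝ ∞ (fun C => T.colScale C j) C) ∧
      ∀ l, ContDiffAt ℝ ∞ (fun C => T.rowScale C l) C := by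
  have happ : ∀ l j, ContDiffAt ℝ ∞ (fun C : L → Fin (d + 1) → ℝ => C l j) C := fun l j =>
    (contDiff_apply_apply ℝ ℝ l j).contDiffAt
  have hne := T.scale_ne_zero hC
  refine T.induction ?_ (fun l hl => ?_) fun j hj hl => ?_
  · simp only [colScale_zero]
    exact contDiffAt_const
  · simp only [rowScale_eq]
    exact ((happ _ _).mul hl).inv (mul_ne_zero (hC _ _ (T.isEdge_rowParent l)) (hne.1 _))
  · simp only [colScale_eq _ _ hj]
    exact ((happ _ _).mul hl).inv (mul_ne_zero (hC _ _ (T.isEdge_colParent hj)) (hne.2 _))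

/-- The matrix `C` with rows and columns scaled such that the entries at the edges are `1`. -/
noncomputable def normalize (C : L → Fin (d + 1) → ℝ) (l : L) (j : Fin (d + 1)) : ℝ :=
  T.rowScale C l * C l j * T.colScale C j

theorem normalize_of_isEdge {C : L → Fin (d + 1) → ℝ} (hC : ∀ l j, T.IsEdge l j → C l j ≠ 0)
    {l : L} {j : Fin (d + 1)} (h : T.IsEdge l j) : T.normalize C l j = 1 := by
  have hne := T.scale_ne_zero hC
  have hlj := hC l j h
  rw [normalize]
  rcases h with rfl | ⟨hj, rfl⟩
  · rw [mul_assoc, rowScale_eq]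
    exact inv_mul_cancel₀ (mul_ne_zero hlj (hne.1 _))
  · rw [mul_comm (T.rowScale C _), T.colScale_eq _ hj]
    exact mul_inv_cancel₀ (mul_ne_zero hlj (hne.2 _))

theorem contDiffAt_normalize [Fintype L] {C : L → Fin (d + 1) → ℝ}
    (hC : ∀ l j, T.IsEdge l j → C l j ≠ 0) (l : L) (j : Fin (d + 1)) :
    ContDiffAt ℝ ∞ (fun C => T.normalize C l j) C :=
  (((T.contDiffAt_scale hC).2 l).mul (contDiff_apply_apply ℝ ℝ l j).contDiffAt).mul
    ((T.contDiffAt_scale hC).1 j)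

end SpanningTree

-- Coefficients with respect to a frame

section Coefficients

variable (τ : Fin (d + 1) ⊕ L ≃ Fin k)

/-- The square matrix formed by the landmarks that serve as a frame. -/
def frame (P : Fin k → Fin (d + 1) → ℝ) : Matrix (Fin (d + 1)) (Fin (d + 1)) ℝ :=
  Matrix.of fun j => P (τ (Sum.inl j))

/-- The coordinates, up to the common factor `det (frame τ P)`, of the other landmarks with respect
to the frame. -/
def coeffs (P : Fin k → Fin (d + 1) → ℝ) (l : L) : Fin (d + 1) → ℝ :=
  Matrix.vecMul (P (τ (Sum.inr l))) (frame τ P).adjugate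

theorem frame_vecMul_adjugate (P : Fin k → Fin (d + 1) → ℝ) (j : Fin (d + 1)) :
    Matrix.vecMul (P (τ (Sum.inl j))) (frame τ P).adjugate =
      Pi.single j (frame τ P).det := by
  have h := congr_fun (Matrix.mul_adjugate (frame τ P)) j
  rw [Matrix.mul_apply_eq_vecMul] at h
  refine h.trans ?_
  ext i
  rw [Matrix.smul_apply, Matrix.one_apply, Pi.single_apply, smul_eq_mul, mul_ite, mul_one, mul_zero]
  simp only [eq_comm]

theorem contDiff_det_of_contDiff {E : Type*} [NormedAddCommGroup E] [NormedSpace ℝ E] {m : ℕ}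
    {M : E → Matrix (Fin m) (Fin m) ℝ} (hM : ∀ i j, ContDiff ℝ ∞ fun x => M x i j) :
    ContDiff ℝ ∞ fun x => (M x).det := by
  simp only [Matrix.det_apply]
  exact ContDiff.sum fun σ _ => (contDiff_prod fun i _ => hM _ _).const_smul _

theorem contDiff_frame_det : ContDiff ℝ ∞ fun P => (frame τ P).det :=
  contDiff_det_of_contDiff fun _ _ => contDiff_apply_apply ℝ ℝ _ _

/-- With the adjugate in place of the inverse, the coefficients are polynomials, smooth even where
the frame degenerates. -/
theorem contDiff_coeffs (l : L) (j : Fin (d + 1)) :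
    ContDiff ℝ ∞ fun P => coeffs τ P l j := by
  simp only [coeffs, Matrix.vecMul, dotProduct]
  refine ContDiff.sum fun i _ => (contDiff_apply_apply ℝ ℝ _ _).mul ?_
  simp only [Matrix.adjugate_apply]
  refine contDiff_det_of_contDiff fun a b => ?_
  by_cases ha : a = j
  · subst ha
    simp only [Matrix.updateRow_self]
    exact contDiff_const
  · simp only [Matrix.updateRow_ne ha]
    exact contDiff_apply_apply ℝ ℝ _ _

variable (T : SpanningTree d L)

/-- The matrices with linearly independent frame whose coefficients do not vanish at the edges. -/
def chartDomain : Set (HomCoords d k) :=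
  {P | (frame τ P.1).det ≠ 0 ∧ ∀ l j, T.IsEdge l j → coeffs τ P.1 l j ≠ 0}

theorem isOpen_chartDomain [Finite L] : IsOpen (chartDomain τ T) := by
  simp only [chartDomain, Set.ofPred_and, Set.ofPred_forall]
  refine IsOpen.inter ?_ (isOpen_iInter_of_finite fun l => isOpen_iInter_of_finite fun j =>
    isOpen_iInter_of_finite fun _ => ?_)
  · exact isOpen_ne_fun ((contDiff_frame_det τ).continuous.comp continuous_subtype_val)
      continuous_const
  · exact isOpen_ne_fun ((contDiff_coeffs τ l j).continuous.comp continuous_subtype_val)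
      continuous_const

/-- A projectivity with row scalings multiplies the frame determinant and every coefficient by
nonzero factors, so the domain is saturated. -/
theorem SameShape.mem_chartDomain {P Q : HomCoords d k} (h : SameShape P Q)
    (hP : P ∈ chartDomain τ T) : Q ∈ chartDomain τ T := by
  obtain ⟨A, c, hc⟩ := h
  have hA : A.1.transpose.det ≠ 0 := by
    rw [Matrix.det_transpose]
    exact A.det_ne_zero
  let γ : Fin (d + 1) → ℝ := fun j => c (τ (Sum.inl j))
  have hframe : frame τ Q.1 = Matrix.diagonal γ * frame τ P.1 * A.1.transpose := by
    ext i j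
    rw [Matrix.mul_assoc, Matrix.diagonal_mul, frame, Matrix.of_apply, hc, Pi.smul_apply,
      smul_eq_mul, Matrix.mul_apply_eq_vecMul, Matrix.vecMul_transpose]
    rfl
  refine ⟨?_, fun l j hlj => ?_⟩
  · rw [hframe, Matrix.det_mul, Matrix.det_mul, Matrix.det_diagonal]
    exact mul_ne_zero (mul_ne_zero (Finset.prod_ne_zero_iff.2 fun j _ => (c _).ne_zero) hP.1) hA
  · have hcoeff : coeffs τ Q.1 l j = c (τ (Sum.inr l)) * (A.1.transpose.det *
        (coeffs τ P.1 l j * ∏ i ∈ Finset.univ.erase j, γ i)) := by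
      rw [coeffs, hframe, Matrix.adjugate_mul_distrib, Matrix.adjugate_mul_distrib, hc,
        ← Matrix.vecMul_transpose, Matrix.smul_vecMul, Pi.smul_apply, smul_eq_mul,
        Matrix.vecMul_vecMul, ← Matrix.mul_assoc, Matrix.mul_adjugate, Matrix.smul_mul,
        Matrix.one_mul, Matrix.vecMul_smul, Pi.smul_apply, smul_eq_mul, ← Matrix.vecMul_vecMul,
        Matrix.adjugate_diagonal, Matrix.vecMul_diagonal]
      rfl
    rw [hcoeff]
    exact mul_ne_zero (c _).ne_zero (mul_ne_zero hA (mul_ne_zero (hP.2 l j hlj)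
      (Finset.prod_ne_zero_iff.2 fun i _ => (c _).ne_zero)))

end Coefficients

-- The chart of a frame and a spanning tree

section Chart

variable (τ : Fin (d + 1) ⊕ L ≃ Fin k) (T : SpanningTree d L)
  (ε : {e : L × Fin (d + 1) // ¬ T.IsEdge e.1 e.2} ≃ Fin (d * (k - d - 2)))

open Classical in
/-- The normalized matrix whose entries at the non-edges are given by `x`. -/
noncomputable def treeMatrix (x : Model d k) (l : L) (j : Fin (d + 1)) : ℝ :=
  if h : T.IsEdge l j then 1 else x (ε ⟨(l, j), h⟩)

theorem treeMatrix_of_isEdge (x : Model d k) {l : L} {j : Fin (d + 1)} (h : T.IsEdge l j) :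
    treeMatrix T ε x l j = 1 := dif_pos h

theorem treeMatrix_of_not_isEdge (x : Model d k) {l : L} {j : Fin (d + 1)}
    (h : ¬ T.IsEdge l j) : treeMatrix T ε x l j = x (ε ⟨(l, j), h⟩) := dif_neg h

theorem contDiff_treeMatrix (l : L) (j : Fin (d + 1)) :
    ContDiff ℝ ∞ fun x => treeMatrix T ε x l j := by
  by_cases h : T.IsEdge l j
  · simp only [treeMatrix_of_isEdge T ε _ h]
    exact contDiff_const
  · simp only [treeMatrix_of_not_isEdge T ε _ h]
    fun_prop

theorem treeMatrix_injective {x y : Model d k} (h : treeMatrix T ε x = treeMatrix T ε y) :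
    x = y := by
  ext i
  obtain ⟨⟨⟨l, j⟩, he⟩, rfl⟩ := ε.surjective i
  have := congr_fun (congr_fun h l) j
  rwa [treeMatrix_of_not_isEdge T ε _ he, treeMatrix_of_not_isEdge T ε _ he] at this

/-- Homogeneous coordinates of the shape with chart coordinates `x`. -/
noncomputable def chartSection (x : Model d k) : HomCoords d k :=
  ⟨fun i => Sum.elim (fun j => Pi.single j 1) (treeMatrix T ε x) (τ.symm i), fun i => by
    obtain ⟨j | l, rfl⟩ := τ.surjective i
    · beta_reduce
      rw [Equiv.symm_apply_apply, Sum.elim_inl, Ne, Pi.single_eq_zero_iff]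
      exact one_ne_zero
    · beta_reduce
      rw [Equiv.symm_apply_apply, Sum.elim_inr]
      intro h
      have := congr_fun h (T.rowParent l)
      rw [treeMatrix_of_isEdge T ε x (T.isEdge_rowParent l)] at this
      exact one_ne_zero this⟩

theorem chartSection_inl (x : Model d k) (j : Fin (d + 1)) :
    (chartSection τ T ε x).1 (τ (Sum.inl j)) = Pi.single j 1 := by
  simp [chartSection]

theorem chartSection_inr (x : Model d k) (l : L) :
    (chartSection τ T ε x).1 (τ (Sum.inr l)) = treeMatrix T ε x l := by
  simp [chartSection]

theorem contMDiff_chartSection :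
    ContMDiff 𝓘(ℝ, Model d k) 𝓘(ℝ, Fin k → Fin (d + 1) → ℝ) ∞ (chartSection τ T ε) := by
  rw [← ContMDiff.subtypeVal_comp_iff, contMDiff_iff_contDiff, contDiff_pi]
  intro i
  obtain ⟨j | l, rfl⟩ := τ.surjective i
  · simp only [Function.comp_apply, chartSection_inl]
    exact contDiff_const
  · simp only [Function.comp_apply, chartSection_inr]
    exact contDiff_pi.2 fun j => contDiff_treeMatrix T ε l j

theorem frame_chartSection (x : Model d k) : frame τ (chartSection τ T ε x).1 = 1 := by
  ext i j
  rw [frame, Matrix.of_apply, chartSection_inl, Pi.single_apply, Matrix.one_apply]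
  simp only [eq_comm]

theorem coeffs_chartSection (x : Model d k) :
    coeffs τ (chartSection τ T ε x).1 = treeMatrix T ε x := by
  ext l j
  rw [coeffs, frame_chartSection, Matrix.adjugate_one, Matrix.vecMul_one, chartSection_inr]

theorem chartSection_mem_chartDomain (x : Model d k) :
    chartSection τ T ε x ∈ chartDomain τ T := by
  refine ⟨?_, fun l j h => ?_⟩
  · rw [frame_chartSection, Matrix.det_one]
    exact one_ne_zero
  · rw [coeffs_chartSection, treeMatrix_of_isEdge T ε x h]
    exact one_ne_zero

/-- The chart as a function of the homogeneous coordinates. -/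
noncomputable def chartCoords (P : Fin k → Fin (d + 1) → ℝ) : Model d k :=
  WithLp.toLp 2 fun i => T.normalize (coeffs τ P) (ε.symm i).1.1 (ε.symm i).1.2

theorem chartCoords_chartSection (x : Model d k) :
    chartCoords τ T ε (chartSection τ T ε x).1 = x := by
  ext i
  obtain ⟨⟨⟨l, j⟩, he⟩, rfl⟩ := ε.surjective i
  have h := T.scale_eq_one fun l j => treeMatrix_of_isEdge T ε x (l := l) (j := j)
  simp only [chartCoords, Equiv.symm_apply_apply, coeffs_chartSection, SpanningTree.normalize]
  rw [h.1, h.2, one_mul, mul_one, treeMatrix_of_not_isEdge T ε x he]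

theorem treeMatrix_chartCoords {P : HomCoords d k} (hP : P ∈ chartDomain τ T) :
    treeMatrix T ε (chartCoords τ T ε P.1) = T.normalize (coeffs τ P.1) := by
  ext l j
  by_cases h : T.IsEdge l j
  · rw [treeMatrix_of_isEdge T ε _ h, T.normalize_of_isEdge hP.2 h]
  · rw [treeMatrix_of_not_isEdge T ε _ h]
    simp [chartCoords]

theorem contDiffAt_chartCoords [Fintype L] {P : HomCoords d k} (hP : P ∈ chartDomain τ T) :
    ContDiffAt ℝ ∞ (chartCoords τ T ε) P.1 := by
  rw [contDiffAt_euclidean]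
  intro i
  have hC : ContDiffAt ℝ ∞ (coeffs τ) P.1 :=
    contDiffAt_pi.2 fun l => contDiffAt_pi.2 fun j => (contDiff_coeffs τ l j).contDiffAt
  exact (T.contDiffAt_normalize hP.2 _ _).comp P.1 hC

/-- The matrix `M` sends the frame to multiples of the standard basis and applies the column
scaling; the row scalings are absorbed by the choice of homogeneous coordinates. -/
theorem sameShape_chartSection {P : HomCoords d k} (hP : P ∈ chartDomain τ T) :
    SameShape P (chartSection τ T ε (chartCoords τ T ε P.1)) := by
  have hne := T.scale_ne_zero hP.2
  have hdet : (frame τ P.1).det ≠ 0 := hP.1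
  let β := T.colScale (coeffs τ P.1)
  let M : Matrix (Fin (d + 1)) (Fin (d + 1)) ℝ :=
    ((frame τ P.1).adjugate * Matrix.diagonal β).transpose
  have hM : M.det ≠ 0 := by
    rw [Matrix.det_transpose, Matrix.det_mul, Matrix.det_diagonal, Matrix.det_adjugate]
    exact mul_ne_zero (pow_ne_zero _ hdet) (Finset.prod_ne_zero_iff.2 fun j _ => hne.1 j)
  refine ⟨Matrix.GeneralLinearGroup.mkOfDetNeZero M hM, fun i => Sum.elim
    (fun j => (Units.mk0 _ (mul_ne_zero hdet (hne.1 j)))⁻¹) (fun l => Units.mk0 _ (hne.2 l))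
    (τ.symm i), fun i => ?_⟩
  have hmul : (Matrix.GeneralLinearGroup.mkOfDetNeZero M hM).1.mulVec (P.1 i) =
      Matrix.vecMul (Matrix.vecMul (P.1 i) (frame τ P.1).adjugate) (Matrix.diagonal β) := by
    rw [Matrix.vecMul_vecMul]
    exact Matrix.mulVec_transpose _ _
  rw [hmul]
  obtain ⟨j | l, rfl⟩ := τ.surjective i
  · rw [chartSection_inl, frame_vecMul_adjugate]
    beta_reduce
    rw [Equiv.symm_apply_apply, Sum.elim_inl]
    ext s
    rw [Pi.smul_apply, Matrix.vecMul_diagonal, smul_eq_mul]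
    by_cases hs : s = j
    · subst hs
      rw [Pi.single_eq_same, Pi.single_eq_same, Units.val_inv_eq_inv_val, Units.val_mk0,
        inv_mul_cancel₀ (mul_ne_zero hdet (hne.1 s))]
    · rw [Pi.single_eq_of_ne hs, Pi.single_eq_of_ne hs, zero_mul, mul_zero]
  · rw [chartSection_inr, treeMatrix_chartCoords τ T ε hP]
    beta_reduce
    rw [Equiv.symm_apply_apply, Sum.elim_inr]
    ext s
    rw [Pi.smul_apply, Matrix.vecMul_diagonal, smul_eq_mul, Units.val_mk0, ← mul_assoc]
    rfl

/-- `A` preserves the coordinate axes, hence is diagonal. The entries 1 on the edges equate row and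
column factors, and connectedness of the tree makes all of them equal. This gives both injectivity
of the chart inverse and freeness of its values. -/
theorem chartSection_rigid {x y : Model d k} {A : GL (Fin (d + 1)) ℝ} {c : Fin k → ℝˣ}
    (h : ∀ i, (c i : ℝ) • (chartSection τ T ε y).1 i = A.1.mulVec ((chartSection τ T ε x).1 i)) :
    x = y ∧ ∃ a : ℝ, A.1 = Matrix.scalar _ a := by
  let γ : Fin (d + 1) → ℝ := fun j => c (τ (Sum.inl j))
  have hA : A.1 = Matrix.diagonal γ := by
    ext s j
    have := congr_fun (h (τ (Sum.inl j))) s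
    rw [chartSection_inl, chartSection_inl, Matrix.mulVec_single_one] at this
    rw [Matrix.col_apply] at this
    rw [← this, Pi.smul_apply, Matrix.diagonal_apply, Pi.single_apply, smul_eq_mul, mul_ite,
      mul_one, mul_zero]
    by_cases hs : s = j
    · rw [if_pos hs, if_pos hs, hs]
    · rw [if_neg hs, if_neg hs]
  have hrow : ∀ l j, c (τ (Sum.inr l)) * treeMatrix T ε y l j = γ j * treeMatrix T ε x l j := by
    intro l j
    have := congr_fun (h (τ (Sum.inr l))) j
    rwa [chartSection_inr, chartSection_inr, hA, Matrix.mulVec_diagonal] at this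
  have hedge : ∀ l j, T.IsEdge l j → (c (τ (Sum.inr l)) : ℝ) = γ j := fun l j he => by
    have := hrow l j
    rwa [treeMatrix_of_isEdge T ε x he, treeMatrix_of_isEdge T ε y he, mul_one, mul_one] at this
  have hconst := T.induction (p := fun j => γ j = γ 0) (q := fun l => (c (τ (Sum.inr l)) : ℝ) = γ 0)
    rfl (fun l hl => (hedge _ _ (T.isEdge_rowParent l)).trans hl)
    fun j hj hl => (hedge _ _ (T.isEdge_colParent hj)).symm.trans hl
  refine ⟨treeMatrix_injective T ε ?_, γ 0, ?_⟩
  · ext l j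
    have := hrow l j
    rw [hconst.1, hconst.2] at this
    exact (mul_left_cancel₀ (c _).ne_zero this).symm
  · rw [hA, Matrix.scalar_apply]
    congr 1
    exact funext hconst.1

theorem isFree_chartSection (x : Model d k) : IsFree (chartSection τ T ε x) := fun _ _ h =>
  (chartSection_rigid τ T ε fun i => (h i).symm).2

/-- The inverse of the chart. -/
noncomputable def chartInv (x : Model d k) : freeShapes d k :=
  ⟨shapeOfMatrix (chartSection τ T ε x),
    shapeOfMatrix_mem_freeShapes.2 (isFree_chartSection τ T ε x)⟩

theorem chartInv_injective : Function.Injective (chartInv τ T ε) := by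
  intro x y h
  obtain ⟨A, c, hc⟩ := shapeOfMatrix_eq_iff.1 (Subtype.ext_iff.1 h)
  refine (chartSection_rigid τ T ε (A := A) (c := fun i => (c i)⁻¹) fun i => ?_).1
  rw [hc, ← Units.smul_def, ← Units.smul_def, inv_smul_smul]

theorem mem_chartDomain_iff {P : HomCoords d k} :
    P ∈ chartDomain τ T ↔ ∃ x, shapeOfMatrix P = (chartInv τ T ε x).1 := by
  constructor
  · exact fun hP => ⟨_, shapeOfMatrix_eq_iff.2 (sameShape_chartSection τ T ε hP)⟩
  · rintro ⟨x, hx⟩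
    exact (shapeOfMatrix_eq_iff.1 hx).symm.mem_chartDomain τ T
      (chartSection_mem_chartDomain τ T ε x)

theorem isOpenEmbedding_chartInv [Fintype L] : Topology.IsOpenEmbedding (chartInv τ T ε) := by
  refine Topology.IsOpenEmbedding.of_continuous_injective_isOpenMap ?_ (chartInv_injective τ T ε) ?_
  · exact Continuous.subtype_mk (isOpenQuotientMap_shapeOfMatrix.continuous.comp
      (contMDiff_chartSection τ T ε).continuous) _
  · intro V hV
    -- The image of `V` is also the image of this open set of matrices under the open map
    -- `shapeOfMatrix`.
    have hO : IsOpen (chartDomain τ T ∩ (fun P => chartCoords τ T ε P.1) ⁻¹' V) := by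
      refine ContinuousOn.isOpen_inter_preimage (fun P hP => ?_) (isOpen_chartDomain τ T) hV
      exact ((contDiffAt_chartCoords τ T ε hP).continuousAt.comp
        continuous_subtype_val.continuousAt).continuousWithinAt
    refine isOpen_induced_iff.2 ⟨_, isOpenQuotientMap_shapeOfMatrix.isOpenMap _ hO, ?_⟩
    ext z
    constructor
    · rintro ⟨P, ⟨hP, hPV⟩, hz⟩
      refine ⟨_, hPV, Subtype.ext ?_⟩
      rw [← hz]
      exact (shapeOfMatrix_eq_iff.2 (sameShape_chartSection τ T ε hP)).symm
    · rintro ⟨x, hx, rfl⟩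
      refine ⟨chartSection τ T ε x, ⟨chartSection_mem_chartDomain τ T ε x, ?_⟩, rfl⟩
      rwa [Set.mem_preimage, chartCoords_chartSection]

/-- The chart of the space of free shapes given by a frame and a spanning tree. -/
noncomputable def treeChart [Fintype L] :
    OpenPartialHomeomorph (freeShapes d k) (Model d k) :=
  ((isOpenEmbedding_chartInv τ T ε).toOpenPartialHomeomorph (chartInv τ T ε)).symm

theorem treeChart_source [Fintype L] :
    (treeChart τ T ε).source = Set.range (chartInv τ T ε) := by
  simp [treeChart]

theorem treeChart_symm_apply [Fintype L] (x : Model d k) :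
    (treeChart τ T ε).symm x = chartInv τ T ε x := by
  simp [treeChart]

theorem treeChart_chartInv [Fintype L] (x : Model d k) :
    treeChart τ T ε (chartInv τ T ε x) = x := by
  rw [← treeChart_symm_apply]
  exact (treeChart τ T ε).right_inv (by simp [treeChart])

theorem preimage_treeChart_source [Fintype L] :
    {P : HomCoords d k | shapeOfMatrix P ∈ Subtype.val '' (treeChart τ T ε).source} =
      chartDomain τ T := by
  ext P
  rw [mem_chartDomain_iff τ T ε, treeChart_source, Set.mem_ofPred_eq, ← Set.range_comp]
  exact exists_congr fun x => eq_comm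

theorem treeChart_mem_smoothCharts [Fintype L] : treeChart τ T ε ∈ smoothCharts d k := by
  refine ⟨⟨fun P => chartCoords τ T ε P.1, fun P h hP => ?_, ?_⟩, fun x _ => ?_⟩
  · rw [treeChart_source] at hP
    obtain ⟨x, hx⟩ := hP
    have hdom : P ∈ chartDomain τ T :=
      (mem_chartDomain_iff τ T ε).2 ⟨x, (Subtype.ext_iff.1 hx).symm⟩
    have : (⟨shapeOfMatrix P, h⟩ : freeShapes d k) =
        chartInv τ T ε (chartCoords τ T ε P.1) :=
      Subtype.ext (shapeOfMatrix_eq_iff.2 (sameShape_chartSection τ T ε hdom))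
    rw [this, treeChart_chartInv]
  · rw [preimage_treeChart_source]
    intro P hP
    exact ((contDiffAt_chartCoords τ T ε hP).contMDiffAt.comp P
      contMDiff_subtype_val.contMDiffAt).contMDiffWithinAt
  · refine ⟨chartSection τ T ε, (contMDiff_chartSection τ T ε).contMDiffAt, ?_⟩
    exact Filter.Eventually.of_forall fun y => by rw [treeChart_symm_apply]; rfl

end Chart

-- Free shapes are covered by charts

/-- The columns that can be reached from the column `0` in `n` steps, where a step connects two
columns if `C` has a row in which both entries do not vanish. -/
def reachableIn (C : L → Fin (d + 1) → ℝ) : ℕ → Set (Fin (d + 1))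
  | 0 => {0}
  | n + 1 => {j | ∃ l, C l j ≠ 0 ∧ ∃ j' ∈ reachableIn C n, C l j' ≠ 0}

/-- Breadth-first search from column 0; `hconn` is connectedness of the graph of nonzero entries,
expressed through sets of columns closed under sharing a row. -/
theorem exists_spanningTree [Nonempty L] {C : L → Fin (d + 1) → ℝ} (hC : ∀ l, C l ≠ 0)
    (hconn : ∀ X : Set (Fin (d + 1)), 0 ∈ X →
      (∀ l j j', C l j ≠ 0 → C l j' ≠ 0 → j ∈ X → j' ∈ X) → ∀ j, j ∈ X) :
    ∃ T : SpanningTree d L, ∀ l j, T.IsEdge l j → C l j ≠ 0 := by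
  classical
  have hcol : ∀ j, ∃ n, j ∈ reachableIn C n := by
    refine fun j => hconn {j | ∃ n, j ∈ reachableIn C n} ⟨0, rfl⟩ ?_ j
    rintro l i i' hi hi' ⟨n, hn⟩
    exact ⟨n + 1, l, hi', i, hn, hi⟩
  have hrow : ∀ l, ∃ n, ∃ j ∈ reachableIn C n, C l j ≠ 0 := by
    intro l
    obtain ⟨j, hj⟩ := Function.ne_iff.1 (hC l)
    obtain ⟨n, hn⟩ := hcol j
    exact ⟨n, j, hn, hj⟩
  have hcp : ∀ j, ∃ l, j ≠ 0 → C l j ≠ 0 ∧ Nat.find (hrow l) < Nat.find (hcol j) := by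
    intro j
    by_cases hj : j = 0
    · exact ⟨Classical.arbitrary L, fun h => absurd hj h⟩
    · have hmem := Nat.find_spec (hcol j)
      obtain ⟨n, hn⟩ : ∃ n, Nat.find (hcol j) = n + 1 := by
        refine Nat.exists_eq_succ_of_ne_zero fun h0 => hj ?_
        rw [h0] at hmem
        exact hmem
      rw [hn] at hmem
      obtain ⟨l, hl, h⟩ := hmem
      refine ⟨l, fun _ => ⟨hl, ?_⟩⟩
      have := Nat.find_min' (hrow l) h
      omega
  choose cp hcp using hcp
  choose rp hrp hrp' using fun l => Nat.find_spec (hrow l)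
  -- Even heights for columns and odd ones for rows: a row at distance `n` is placed between columns
  -- at distances `n` and `n + 1`.
  refine ⟨⟨cp, rp, fun j => 2 * Nat.find (hcol j), fun l => 2 * Nat.find (hrow l) + 1,
    fun j hj => ?_, fun l => ?_⟩, ?_⟩
  · have := (hcp j hj).2
    omega
  · have := Nat.find_min' (hcol (rp l)) (hrp l)
    omega
  · rintro l j (rfl | ⟨hj, rfl⟩)
    · exact hrp' l
    · exact (hcp j hj).1

theorem IsFree.exists_eq_smul {P : HomCoords d k} (hP : IsFree P)
    {f : (Fin (d + 1) → ℝ) →ₗ[ℝ] (Fin (d + 1) → ℝ)} (hf : Function.Injective f) {c : Fin k → ℝ}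
    (h : ∀ l, f (P.1 l) = c l • P.1 l) : ∃ a : ℝ, ∀ v, f v = a • v := by
  have hdet : (LinearMap.toMatrix' f).det ≠ 0 := by
    rw [LinearMap.det_toMatrix']
    exact (LinearMap.isUnit_iff_isUnit_det f).1
      ((LinearMap.isUnit_iff_ker_eq_bot f).2 (LinearMap.ker_eq_bot.2 hf)) |>.ne_zero
  have hc : ∀ l, c l ≠ 0 := fun l h0 => by
    have := h l
    rw [h0, zero_smul, ← map_zero f] at this
    exact P.2 l (hf this)
  obtain ⟨a, ha⟩ := hP (Matrix.GeneralLinearGroup.mkOfDetNeZero _ hdet)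
    (fun l => Units.mk0 (c l) (hc l)) fun l => by
      rw [Units.val_mk0, ← h]
      exact LinearMap.toMatrix'_mulVec f _
  refine ⟨a, fun v => ?_⟩
  have hv : (LinearMap.toMatrix' f).mulVec v = (Matrix.scalar _ a).mulVec v :=
    congr_arg (fun M => M.mulVec v) ha
  rw [LinearMap.toMatrix'_mulVec] at hv
  rw [hv, Matrix.scalar_apply, ← Matrix.smul_one_eq_diagonal, Matrix.smul_mulVec,
    Matrix.one_mulVec]

/-- Otherwise a functional `φ ≠ 0` kills all landmarks, and `u ↦ u + φ u • v` with `φ v = 1` fixes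
every landmark but doubles `v`. -/
theorem IsFree.span_eq_top (hk : 0 < k) {P : HomCoords d k} (hP : IsFree P) :
    Submodule.span ℝ (Set.range P.1) = ⊤ := by
  by_contra hne
  obtain ⟨φ, hφ, hle⟩ := Submodule.exists_le_ker_of_lt_top _ (lt_top_iff_ne_top.2 hne)
  obtain ⟨w, hw⟩ := DFunLike.ne_iff.1 hφ
  let v : Fin (d + 1) → ℝ := (φ w)⁻¹ • w
  have hv : φ v = 1 := by
    rw [map_smul, smul_eq_mul]
    exact inv_mul_cancel₀ hw
  have hφP : ∀ l, φ (P.1 l) = 0 := fun l => hle (Submodule.subset_span ⟨l, rfl⟩)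
  let f : (Fin (d + 1) → ℝ) →ₗ[ℝ] (Fin (d + 1) → ℝ) := LinearMap.id + φ.smulRight v
  have hf : ∀ u, f u = u + φ u • v := fun _ => rfl
  have hinj : Function.Injective f := by
    rw [injective_iff_map_eq_zero]
    intro u hu
    rw [hf] at hu
    have h := congr_arg φ hu
    rw [map_add, map_smul, hv, map_zero, smul_eq_mul, mul_one] at h
    have h0 : φ u = 0 := by linarith
    rwa [h0, zero_smul, add_zero] at hu
  obtain ⟨a, ha⟩ := hP.exists_eq_smul hinj (c := 1) fun l => by
    rw [hf, hφP, zero_smul, add_zero, Pi.one_apply, one_smul]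
  have h₁ := ha (P.1 ⟨0, hk⟩)
  rw [hf, hφP, zero_smul, add_zero] at h₁
  have ha1 : a = 1 := by
    by_contra h
    have : (a - 1) • P.1 ⟨0, hk⟩ = 0 := by rw [sub_smul, one_smul, ← h₁, sub_self]
    exact (smul_ne_zero (sub_ne_zero.2 h) (P.2 _)) this
  have h₂ := ha v
  rw [hf, hv, ha1, one_smul] at h₂
  rw [add_eq_left.1 h₂, map_zero] at hv
  exact zero_ne_one hv

theorem IsFree.exists_frame (hk : 0 < k) {P : HomCoords d k} (hP : IsFree P) :
    ∃ (L : Type) (_ : Fintype L) (τ : Fin (d + 1) ⊕ L ≃ Fin k), (frame τ P.1).det ≠ 0 := by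
  classical
  obtain ⟨f, hf, -, hli⟩ := Submodule.exists_fun_fin_finrank_span_eq ℝ (Set.range P.1)
  have hr : finrank ℝ (Submodule.span ℝ (Set.range P.1)) = d + 1 := by
    rw [hP.span_eq_top hk, finrank_top, finrank_fin_fun]
  choose g hg using hf
  let σ : Fin (d + 1) → Fin k := fun j => g (Fin.cast hr.symm j)
  have hσ : LinearIndependent ℝ fun j => P.1 (σ j) := by
    simp only [σ, hg]
    exact hli.comp _ (Fin.cast_injective hr.symm)
  have hσinj : Function.Injective σ := fun i j h => hσ.injective (congr_arg P.1 h)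
  refine ⟨↥(Set.range σ)ᶜ, inferInstance, ((Equiv.ofInjective σ hσinj).sumCongr
    (Equiv.refl _)).trans (Equiv.Set.sumCompl (Set.range σ)), ?_⟩
  have : LinearIndependent ℝ (Matrix.of fun j => P.1 (σ j)).row := hσ
  exact ((Matrix.isUnit_iff_isUnit_det _).1
    (Matrix.linearIndependent_rows_iff_isUnit.1 this)).ne_zero

/-- Freeness forces connectedness: a union of components of the graph could be scaled independently
of the rest. -/
theorem IsFree.exists_mem_chartDomain [Nonempty L] {P : HomCoords d k} (hP : IsFree P)
    {τ : Fin (d + 1) ⊕ L ≃ Fin k} (hdet : (frame τ P.1).det ≠ 0) :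
    ∃ T : SpanningTree d L, P ∈ chartDomain τ T := by
  classical
  have hadj : (frame τ P.1).adjugate.transpose.det ≠ 0 := by
    rw [Matrix.det_transpose, Matrix.det_adjugate]
    exact pow_ne_zero _ hdet
  let Q : HomCoords d k := ⟨fun i => (frame τ P.1).adjugate.transpose.mulVec (P.1 i), fun i h =>
    P.2 i (Matrix.eq_zero_of_mulVec_eq_zero hadj h)⟩
  have hPQ : SameShape P Q := ⟨Matrix.GeneralLinearGroup.mkOfDetNeZero _ hadj, 1, fun i => by
    rw [Pi.one_apply, Units.val_one, one_smul]
    rfl⟩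
  have hQ : IsFree Q := by
    rw [← shapeOfMatrix_mem_freeShapes, ← shapeOfMatrix_eq_iff.2 hPQ, shapeOfMatrix_mem_freeShapes]
    exact hP
  have hQl : ∀ j, Q.1 (τ (Sum.inl j)) = Pi.single j (frame τ P.1).det := fun j =>
    (Matrix.mulVec_transpose _ _).trans (frame_vecMul_adjugate τ P.1 j)
  have hQr : ∀ l, Q.1 (τ (Sum.inr l)) = coeffs τ P.1 l := fun l =>
    Matrix.mulVec_transpose (frame τ P.1).adjugate (P.1 (τ (Sum.inr l)))
  obtain ⟨T, hT⟩ := exists_spanningTree (C := coeffs τ P.1) (fun l h => Q.2 _ ((hQr l).trans h))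
    fun X hX0 hX j => by
      -- Every coefficient row is supported inside `X` or outside it, so doubling the coordinates in
      -- `X` fixes all landmarks of `Q` projectively. By freeness this map is scalar, and `0 ∈ X`
      -- leaves no column outside `X`.
      let γ : Fin (d + 1) → ℝ := fun i => if i ∈ X then 2 else 1
      have hγ : ∀ i, γ i ≠ 0 := fun i => by
        simp only [γ]
        split_ifs <;> norm_num
      have hf : ∀ v i, (Matrix.diagonal γ).mulVecLin v i = γ i * v i := fun v i =>
        Matrix.mulVec_diagonal γ v i
      have hinj : Function.Injective (Matrix.diagonal γ).mulVecLin := by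
        intro u v huv
        ext i
        have := congr_fun huv i
        rw [hf, hf] at this
        exact mul_left_cancel₀ (hγ i) this
      obtain ⟨a, ha⟩ := hQ.exists_eq_smul hinj
        (c := fun i => Sum.elim γ
          (fun l => if ∃ j ∈ X, coeffs τ P.1 l j ≠ 0 then 2 else 1) (τ.symm i)) fun i => by
          obtain ⟨j | l, rfl⟩ := τ.surjective i
          · rw [Equiv.symm_apply_apply, Sum.elim_inl, hQl]
            ext s
            rw [hf, Pi.smul_apply, smul_eq_mul]
            by_cases hs : s = j
            · rw [hs]
            · rw [Pi.single_eq_of_ne hs, mul_zero, mul_zero]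
          · rw [Equiv.symm_apply_apply, Sum.elim_inr, hQr]
            ext s
            rw [hf, Pi.smul_apply, smul_eq_mul]
            by_cases hs : coeffs τ P.1 l s = 0
            · rw [hs, mul_zero, mul_zero]
            · congr 1
              refine if_congr ⟨fun h => ⟨s, h, hs⟩, ?_⟩ rfl rfl
              rintro ⟨j', hj', hne⟩
              exact hX l j' s hne hs hj'
      have hγa : ∀ i, γ i = a := fun i => by
        have := congr_fun (ha (Pi.single i 1)) i
        rwa [hf, Pi.smul_apply, Pi.single_eq_same, mul_one, smul_eq_mul, mul_one] at this
      by_contra hj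
      have h₁ := (hγa 0).trans (hγa j).symm
      simp only [γ, if_pos hX0, if_neg hj] at h₁
      norm_num at h₁
  exact ⟨T, hdet, hT⟩

theorem exists_mem_smoothCharts (hk : d + 3 ≤ k) (z : freeShapes d k) :
    ∃ e ∈ smoothCharts d k, z ∈ e.source := by
  classical
  obtain ⟨z, hz⟩ := z
  obtain ⟨P, rfl⟩ := isOpenQuotientMap_shapeOfMatrix.surjective z
  have hP := shapeOfMatrix_mem_freeShapes.1 hz
  obtain ⟨L, _, τ, hdet⟩ := hP.exists_frame (by omega)
  have hcard : d + 1 + Fintype.card L = k := by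
    simpa using Fintype.card_congr τ
  have : Nonempty L := Fintype.card_pos_iff.1 (by omega)
  obtain ⟨T, hT⟩ := hP.exists_mem_chartDomain hdet
  let ε : {e : L × Fin (d + 1) // ¬ T.IsEdge e.1 e.2} ≃ Fin (d * (k - d - 2)) :=
    Fintype.equivFinOfCardEq (by
      rw [T.card_not_isEdge]
      congr 1
      omega)
  refine ⟨treeChart τ T ε, treeChart_mem_smoothCharts τ T ε, ?_⟩
  rw [treeChart_source]
  obtain ⟨x, hx⟩ := (mem_chartDomain_iff τ T ε).1 hT
  exact ⟨x, Subtype.ext hx.symm⟩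

-- The manifold structure and the equivalences

/-- The space of free shapes with its smooth charts. -/
noncomputable abbrev freeShapesChartedSpace (hk : d + 3 ≤ k) :
    ChartedSpace (Model d k) (freeShapes d k) where
  atlas := smoothCharts d k
  chartAt z := (exists_mem_smoothCharts hk z).choose
  mem_chart_source z := (exists_mem_smoothCharts hk z).choose_spec.2
  chart_mem_atlas z := (exists_mem_smoothCharts hk z).choose_spec.1

theorem isOpenHausdorffSubmanifold_of_isOpen (hk : d + 3 ≤ k) {S : Set (ShapeSpace d k)}
    (hS : IsOpen S) (hS' : S ⊆ freeShapes d k) (hT2 : T2Space S) :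
    IsOpenHausdorffSubmanifold S := by
  let _ := freeShapesChartedSpace hk
  have : IsManifold 𝓘(ℝ, Model d k) ∞ (freeShapes d k) :=
    { compatible := fun he he' => smoothCharts_compatible he he' }
  let U : Opens (freeShapes d k) := ⟨Subtype.val ⁻¹' S, hS.preimage continuous_subtype_val⟩
  have hT2U : T2Space U :=
    T2Space.of_injective_continuous (f := fun u : U => (⟨u.1.1, u.2⟩ : S))
      (fun u v h => Subtype.ext (Subtype.ext (congr_arg (fun s : S => s.1) h)))
      (Continuous.subtype_mk (continuous_subtype_val.comp continuous_subtype_val) _)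
  refine ⟨freeShapesChartedSpace hk, rfl, inferInstance, inferInstance, U, ?_, inferInstance, hT2U,
    inferInstance⟩
  exact (Subtype.image_preimage_coe _ _).trans (Set.inter_eq_right.2 hS')

end ProjShape

theorem mainTheorem2 (d k : ℕ) (hd : 1 ≤ d) (hk : d + 3 ≤ k)
    (n : Fin d → ℕ) (hn_pos : ∀ i, 1 ≤ n i) (hn : StrictMono n) :
    List.TFAE
      [T2Space (ProjShape.boundedShapes k n),
       ProjShape.boundedShapes k n ⊆ ProjShape.freeShapes d k,
       ProjShape.IsOpenHausdorffSubmanifold (ProjShape.boundedShapes k n),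
       ∀ i : Fin d, n i + n i.rev < k] := by
  -- Strictly increasing integers grow by at least one per step; this leaves room for the additional
  -- landmarks in the split configurations.
  have hgap : ∀ i j : Fin d, i ≤ j → n i + (j - i : ℕ) ≤ n j := by
    have key : ∀ (t : ℕ) (i j : Fin d), (j : ℕ) = i + t → n i + t ≤ n j := by
      intro t
      induction t with
      | zero => exact fun i j h => by rw [Fin.ext (a := j) (b := i) h, add_zero]
      | succ t ih =>
        intro i j h
        have h₁ := ih i ⟨i + t, by omega⟩ rfl
        have h₂ := @hn ⟨i + t, by omega⟩ j (Fin.lt_def.2 (by simp only; omega))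
        omega
    exact fun i j h => key _ i j (by have := Fin.le_def.1 h; omega)
  have hn' : ∀ i : Fin d, (i : ℕ) + 1 ≤ n i := fun i => by
    have h₁ := hgap ⟨0, hd⟩ i (Fin.le_def.2 (Nat.zero_le _))
    have h₂ := hn_pos ⟨0, hd⟩
    simp only [Nat.sub_zero] at h₁
    omega
  have h41 : (∀ i, n i + n i.rev < k) → T2Space (ProjShape.boundedShapes k n) := fun h =>
    ProjShape.t2Space_boundedShapes hn' h (by omega)
  have h42 : (∀ i, n i + n i.rev < k) →
      ProjShape.boundedShapes k n ⊆ ProjShape.freeShapes d k := by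
    intro h z hz
    obtain ⟨P, rfl⟩ := ProjShape.isOpenQuotientMap_shapeOfMatrix.surjective z
    exact ProjShape.shapeOfMatrix_mem_freeShapes.2
      (((ProjShape.shapeOfMatrix_mem_boundedShapes hn').1 hz).isFree h (by omega))
  tfae_have 1 → 4 := fun h => by
    by_contra hne
    exact ProjShape.not_t2Space_boundedShapes hk hn' hgap hne h
  tfae_have 4 → 1 := h41
  tfae_have 2 → 4 := fun h => by
    by_contra hne
    exact ProjShape.not_boundedShapes_subset_freeShapes hk hn' hgap hne h
  tfae_have 4 → 3 := fun h => ProjShape.isOpenHausdorffSubmanifold_of_isOpen hk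
    (ProjShape.isOpen_boundedShapes hn') (h42 h) (h41 h)
  tfae_have 3 → 2 := by
    rintro ⟨_, _, _, _, U, hU, _⟩
    rw [← hU]
    exact Subtype.coe_image_subset _ _
  tfae_finish
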